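/- Let $d\ge 1$, $0<s<1$, let $\Omega\subset\mathbb{R}^d$ be a bounded open set, and let $0<g_*\le g^*$, $0<k_*\le k^*$ be constants with $s(g_*+1)<d$. Let $g=g(x,y,r)>0$ $(x,y\in\mathbb{R}^d,\ r>0)$ be measurable and such that, for almost every $(x,y)\in\mathbb{R}^d\times\mathbb{R}^d$, and also at $(x,x)$ for almost every $x\in\mathbb{R}^d$: $g(x,y,\cdot)$ is locally Lipschitz on $(0,\infty)$, $\lim_{r\to0^+}r\,g(x,y,r)=0$, $\lim_{r\to\infty}r\,g(x,y,r)=\infty$, $$g_*\le \frac{r\,\partial_r g(x,y,r)}{g(x,y,r)}+1\le g^*\quad\text{for a.e. } r>0,\qquad\text{and}\qquad k_*\le g(x,y,1)\le k^* .$$ Put $G(x,y,r)=\int_0^r g(x,y,\rho)\rho\,d\rho$ and $\delta^su(x,y)=\frac{u(x)-u(y)}{|x-y|^s}$. For measurable $u:\mathbb{R}^d\to\mathbb{R}$ let $$\Gamma_{\hat G}(u)=\int_{\mathbb{R}^d}G(x,x,|u(x)|)\,dx,\qquad \Gamma_{s,G}(u)=\int_{\mathbb{R}^d}\!\int_{\mathbb{R}^d}G(x,y,|\delta^su(x,y)|)\frac{dx\,dy}{|x-y|^d},$$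 $$\|u\|_{s,G}=\inf\{\lambda>0:\Gamma_{\hat G}(u/\lambda)\le1\}+\inf\{\lambda>0:\Gamma_{s,G}(u/\lambda)\le1\}.$$ Let $W^{s,G}(\mathbb{R}^d)$ be the space of measurable $u$ with $\Gamma_{\hat G}(u)<\infty$ and $\Gamma_{s,G}(u)<\infty$, and let $W^{s,G}_0(\Omega)$ be the closure of $C_c^\infty(\Omega)$ in it with respect to $\|\cdot\|_{s,G}$. Let $\frac{d}{s(g_*+1)}<m\le\infty$ and $f\in L^m(\Omega)$, and let $u\in W^{s,G}_0(\Omega)$ be the solution of the Dirichlet problem $\mathcal{L}_g^su=f$, that is, $$\int_{\mathbb{R}^d}\!\int_{\mathbb{R}^d}g(x,y,|\delta^su|)\,\delta^su\,\delta^sv\,\frac{dx\,dy}{|x-y|^d}=\int_\Omega f v\,dx\qquad\text{for all } v\in W^{s,G}_0(\Omega).$$ Then there is a constant $C$, depending only on $g_*,g^*,k_*,k^*,d,s,\Omega,m$, $\|u\|_{s,G}$ and $\|f\|_{L^m(\Omega)}$, such that $$\|u\|_{L^\infty(\Omega)}\le C.$$ -/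

import Mathlib

open MeasureTheory Set Filter Topology
open scoped ENNReal NNReal ContDiff

namespace FracOrlicz

/-- The Euclidean space `ℝ^d`. -/
abbrev Sp (d : ℕ) : Type := EuclideanSpace ℝ (Fin d)

/-- The conditions on the profile `h = g(x,y,·)` at one pair of points `(x,y)`; only the values
`h r` with `r > 0` matter.  The derivative of the locally Lipschitz function `h` exists at almost
every `r > 0`, and the growth condition is asked for at almost every `r > 0`. -/
structure IsProfile (gLo gUp kLo kUp : ℝ) (h : ℝ → ℝ) : Prop where
  pos : ∀ r : ℝ, 0 < r → 0 < h r
  lipschitz : LocallyLipschitzOn (Ioi (0 : ℝ)) h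
  tendsto_zero : Tendsto (fun r : ℝ => r * h r) (𝓝[>] 0) (𝓝 0)
  tendsto_top : Tendsto (fun r : ℝ => r * h r) atTop atTop
  growth : ∀ᵐ r : ℝ, 0 < r →
    gLo ≤ r * deriv h r / h r + 1 ∧ r * deriv h r / h r + 1 ≤ gUp
  bounds : kLo ≤ h 1 ∧ h 1 ≤ kUp

/-- The nonlinearities `g(x,y,r)`: measurable, with the above conditions for almost every pair
`(x,y)`, and also at almost every point `(x,x)` of the (null) diagonal, where `g` enters the norm
through `G(x,x,·)`. -/
structure IsNonlinearity {d : ℕ} (gLo gUp kLo kUp : ℝ) (g : Sp d → Sp d → ℝ → ℝ) : Prop where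
  measurable : Measurable (fun z : Sp d × Sp d × ℝ => g z.1 z.2.1 z.2.2)
  ae_profile : ∀ᵐ z : Sp d × Sp d, IsProfile gLo gUp kLo kUp (g z.1 z.2)
  ae_profile_diag : ∀ᵐ x : Sp d, IsProfile gLo gUp kLo kUp (g x x)

/-- The primitive `G(x,y,r) = ∫₀^r g(x,y,ρ) ρ dρ`. -/
noncomputable def primG {d : ℕ} (g : Sp d → Sp d → ℝ → ℝ) (x y : Sp d) (r : ℝ) : ℝ :=
  ∫ ρ in (0 : ℝ)..r, g x y ρ * ρ

/-- The difference quotient `δ^s u(x,y) = (u(x) - u(y)) / |x - y|^s`. -/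
noncomputable def diffQuot {d : ℕ} (s : ℝ) (u : Sp d → ℝ) (x y : Sp d) : ℝ :=
  (u x - u y) / ‖x - y‖ ^ s

/-- The modular `∫ G(x,x,|u(x)|) dx`. -/
noncomputable def modular {d : ℕ} (g : Sp d → Sp d → ℝ → ℝ) (u : Sp d → ℝ) : ℝ≥0∞ :=
  ∫⁻ x : Sp d, ENNReal.ofReal (primG g x x |u x|)

/-- The modular `∫∫ G(x,y,|δ^s u(x,y)|) |x-y|^{-d} dx dy`. -/
noncomputable def fracModular {d : ℕ} (s : ℝ) (g : Sp d → Sp d → ℝ → ℝ) (u : Sp d → ℝ) : ℝ≥0∞ :=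
  ∫⁻ z : Sp d × Sp d,
    ENNReal.ofReal (primG g z.1 z.2 |diffQuot s u z.1 z.2|) / ENNReal.ofReal (‖z.1 - z.2‖ ^ d)

/-- The Luxemburg functional of a modular (with value `∞` if there is no admissible `l`). -/
noncomputable def luxemburg {d : ℕ} (Γ : (Sp d → ℝ) → ℝ≥0∞) (u : Sp d → ℝ) : ℝ≥0∞ :=
  sInf (ENNReal.ofReal '' {l : ℝ | 0 < l ∧ Γ (fun x => u x / l) ≤ 1})

/-- The norm `‖u‖_{s,G} = ‖u‖_G + [u]_{s,G}`. -/
noncomputable def normSG {d : ℕ} (s : ℝ) (g : Sp d → Sp d → ℝ → ℝ) (u : Sp d → ℝ) : ℝ≥0∞ :=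
  luxemburg (modular g) u + luxemburg (fracModular s g) u

/-- Membership in `W^{s,G}(ℝ^d)`. -/
structure MemW {d : ℕ} (s : ℝ) (g : Sp d → Sp d → ℝ → ℝ) (u : Sp d → ℝ) : Prop where
  aestronglyMeasurable : AEStronglyMeasurable u volume
  modular_lt_top : modular g u < ⊤
  fracModular_lt_top : fracModular s g u < ⊤

/-- `C_c^∞(Ω)`, as functions on `ℝ^d`. -/
structure IsTestFunction {d : ℕ} (Ω : Set (Sp d)) (φ : Sp d → ℝ) : Prop where
  contDiff : ContDiff ℝ ∞ φ
  hasCompactSupport : HasCompactSupport φ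
  tsupport_subset : tsupport φ ⊆ Ω

/-- Membership in `W^{s,G}_0(Ω)`, the closure of `C_c^∞(Ω)` in `W^{s,G}(ℝ^d)`. -/
structure MemW0 {d : ℕ} (s : ℝ) (g : Sp d → Sp d → ℝ → ℝ) (Ω : Set (Sp d)) (u : Sp d → ℝ) :
    Prop where
  memW : MemW s g u
  closure : ∀ ε : ℝ≥0∞, 0 < ε → ∃ φ : Sp d → ℝ,
    IsTestFunction Ω φ ∧ normSG s g (fun x => u x - φ x) < ε

/-- The duality `⟨L_g^s u, v⟩`. -/
noncomputable def pairing {d : ℕ} (s : ℝ) (g : Sp d → Sp d → ℝ → ℝ) (u v : Sp d → ℝ) : ℝ :=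
  ∫ z : Sp d × Sp d,
    g z.1 z.2 |diffQuot s u z.1 z.2| * diffQuot s u z.1 z.2 * diffQuot s v z.1 z.2
      / ‖z.1 - z.2‖ ^ d

/-- `u` is a variational solution of `L_g^s u = f` in `Ω`, `u = 0` outside `Ω`. -/
structure IsSolution {d : ℕ} (s : ℝ) (g : Sp d → Sp d → ℝ → ℝ) (Ω : Set (Sp d))
    (f u : Sp d → ℝ) : Prop where
  memW0 : MemW0 s g Ω u
  weak : ∀ v : Sp d → ℝ, MemW0 s g Ω v → pairing s g u v = ∫ x in Ω, f x * v x

end FracOrlicz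

/-! The proof is a De Giorgi iteration on the measures `a k` of the sets {|u| > k}, with no Sobolev
embedding. Write p = `gLo` + 1, σ = sp/d and α = 1/m (α = 0 if m = ∞).

The test function is T(u), where T is a smooth monotone contraction that vanishes on [-k, k] and has
constant modulus θt beyond ±(k + t). Smoothness keeps T(u) in the closure of the test functions
(`MemW0.comp`). Monotonicity makes the density of the duality nonnegative, so the duality dominates
its integral over any set of pairs.

That set consists of the pairs (x, y) with |u(x)| > k + t, |u(y)| ≤ k and |x - y| < r, where balls
of radius r have measure 2 `a k`. At least half of each ball lies outside {|u| > k}, so the set has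
measure comparable to `a (k + t) * a k` (`volume_pairs_bounds`). On it T(u) jumps by exactly θt, and
the growth of g bounds the density from below (`rpow_le_pairDens`).

Testing the equation and applying Hölder to f on {|u| > k} gives `IsSolution.level_step`: up to
constants, t^p `a (k + t)` ≤ (`a k`)^σ (t (`a k`)^(1-α) + `a k`). The condition on m says σ > α, so
the right side is superlinear in `a k`. Since p > 1, a large top level M makes the iteration
converge from the trivial bound by the measure of Ω (`exists_vanishing_level`). The resulting bound
depends on f only through its norm and does not involve the norm of u. -/

namespace FracOrlicz

/-! ### Growth estimates for a single profile -/

/-- The primitive `∫₀^r h(ρ) ρ dρ` of a single profile. -/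
noncomputable def prim (h : ℝ → ℝ) (r : ℝ) : ℝ := ∫ ρ in (0 : ℝ)..r, h ρ * ρ

lemma primG_eq_prim {d : ℕ} (g : Sp d → Sp d → ℝ → ℝ) (x y : Sp d) (r : ℝ) :
    primG g x y r = prim (g x y) r := rfl

lemma prim_zero (h : ℝ → ℝ) : prim h 0 = 0 := by simp [prim]

/-- The derivative of a product with a power, integrated. -/
lemma integral_deriv_mul_rpow {h : ℝ → ℝ} (hl : LocallyLipschitzOn (Ioi (0 : ℝ)) h) (e : ℝ)
    {a b : ℝ} (ha : 0 < a) (hab : a ≤ b) :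
    ∫ x in a..b, deriv h x * x ^ e + h x * deriv (fun y : ℝ => y ^ e) x
      = h b * b ^ e - h a * a ^ e := by
  have hsub : uIcc a b ⊆ Ioi 0 := by
    rw [uIcc_of_le hab]
    exact fun x hx => ha.trans_le hx.1
  have h1 : AbsolutelyContinuousOnInterval h a b := by
    obtain ⟨K, hK⟩ := (hl.mono hsub).exists_lipschitzOnWith_of_compact isCompact_uIcc
    exact hK.absolutelyContinuousOnInterval
  have h2 : AbsolutelyContinuousOnInterval (fun y : ℝ => y ^ e) a b := by
    apply ContDiffOn.absolutelyContinuousOnInterval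
    intro x hx
    exact (Real.contDiffAt_rpow_const_of_ne (hsub hx).ne').contDiffWithinAt
  exact AbsolutelyContinuousOnInterval.integral_deriv_mul_eq_sub h1 h2

lemma deriv_mul_rpow_eq {h : ℝ → ℝ} {x : ℝ} (hx : 0 < x) (hh : 0 < h x) (e : ℝ) :
    deriv h x * x ^ e + h x * deriv (fun y : ℝ => y ^ e) x
      = h x * x ^ (e - 1) * (x * deriv h x / h x + e) := by
  rw [Real.deriv_rpow_const]
  have : x ^ e = x ^ (e - 1) * x := by
    rw [← Real.rpow_add_one hx.ne']; simp
  rw [this]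
  field_simp

namespace IsProfile

variable {gLo gUp kLo kUp : ℝ} {h : ℝ → ℝ}

/-- The a.e. derivative of h(r) r^(1-`gLo`) is h(r) r^(-`gLo`) times (r h'/h + 1 - `gLo`), which is
nonnegative; absolute continuity on compact intervals of (0, ∞) allows integrating it. -/
lemma mul_rpow_mono (H : IsProfile gLo gUp kLo kUp h) {a b : ℝ} (ha : 0 < a) (hab : a ≤ b) :
    h a * a ^ (1 - gLo) ≤ h b * b ^ (1 - gLo) := by
  have key := integral_deriv_mul_rpow H.lipschitz (1 - gLo) ha hab
  have : 0 ≤ ∫ x in a..b, deriv h x * x ^ (1 - gLo)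
      + h x * deriv (fun y : ℝ => y ^ (1 - gLo)) x := by
    apply intervalIntegral.integral_nonneg_of_ae_restrict hab
    filter_upwards [ae_restrict_of_ae H.growth, ae_restrict_mem measurableSet_Icc] with x hx hxm
    have hx0 : 0 < x := ha.trans_le hxm.1
    simp only [Pi.zero_apply]
    rw [deriv_mul_rpow_eq hx0 (H.pos x hx0)]
    have := (hx hx0).1
    have h1 := (H.pos x hx0).le
    have h2 : 0 ≤ x * deriv h x / h x + (1 - gLo) := by linarith
    positivity
  linarith

lemma mul_rpow_anti (H : IsProfile gLo gUp kLo kUp h) {a b : ℝ} (ha : 0 < a) (hab : a ≤ b) :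
    h b * b ^ (1 - gUp) ≤ h a * a ^ (1 - gUp) := by
  have key := integral_deriv_mul_rpow H.lipschitz (1 - gUp) ha hab
  have : 0 ≤ ∫ x in a..b, -(deriv h x * x ^ (1 - gUp)
      + h x * deriv (fun y : ℝ => y ^ (1 - gUp)) x) := by
    apply intervalIntegral.integral_nonneg_of_ae_restrict hab
    filter_upwards [ae_restrict_of_ae H.growth, ae_restrict_mem measurableSet_Icc] with x hx hxm
    have hx0 : 0 < x := ha.trans_le hxm.1
    simp only [Pi.zero_apply]
    rw [deriv_mul_rpow_eq hx0 (H.pos x hx0), ← mul_neg]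
    have := (hx hx0).2
    have h1 := (H.pos x hx0).le
    have h2 : 0 ≤ -(x * deriv h x / h x + (1 - gUp)) := by linarith
    positivity
  rw [intervalIntegral.integral_neg] at this
  linarith

lemma mul_self_eq {r : ℝ} (hr : 0 < r) (e : ℝ) (h : ℝ → ℝ) :
    h r * r = h r * r ^ (1 - e) * r ^ e := by
  rw [mul_assoc, ← Real.rpow_add hr]; simp

lemma mul_self_nonneg (H : IsProfile gLo gUp kLo kUp h) {r : ℝ} (hr : 0 ≤ r) : 0 ≤ h r * r := by
  rcases hr.eq_or_lt with rfl | hr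
  · simp
  · exact (mul_pos (H.pos r hr) hr).le

lemma monotoneOn_mul_self (H : IsProfile gLo gUp kLo kUp h) (hg : 0 < gLo) :
    MonotoneOn (fun r => h r * r) (Ici 0) := by
  intro a ha b hb hab
  rcases (mem_Ici.1 ha).eq_or_lt with rfl | ha
  · simpa using H.mul_self_nonneg hb
  · have hb : 0 < b := ha.trans_le hab
    simp only
    rw [mul_self_eq ha gLo, mul_self_eq hb gLo]
    have h1 := H.mul_rpow_mono ha hab
    have h2 : a ^ gLo ≤ b ^ gLo := Real.rpow_le_rpow ha.le hab hg.le
    have h3 := (H.pos b hb).le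
    exact mul_le_mul h1 h2 (by positivity) (by positivity)

lemma mul_self_scale (H : IsProfile gLo gUp kLo kUp h) {C r : ℝ} (hC : 1 ≤ C) (hr : 0 ≤ r) :
    h (C * r) * (C * r) ≤ C ^ gUp * (h r * r) := by
  rcases hr.eq_or_lt with rfl | hr
  · simp
  · have hC0 : 0 < C := by linarith
    have hCr : 0 < C * r := by positivity
    rw [mul_self_eq hCr gUp, mul_self_eq hr gUp]
    have h1 := H.mul_rpow_anti hr (b := C * r) (by nlinarith)
    rw [Real.mul_rpow hC0.le hr.le (z := gUp)]
    have : 0 ≤ C ^ gUp * r ^ gUp := by positivity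
    nlinarith [mul_le_mul_of_nonneg_right h1 this]

lemma rpow_le_mul (H : IsProfile gLo gUp kLo kUp h) {r : ℝ} (hr : 1 ≤ r) :
    kLo * r ^ (gLo + 1) ≤ h r * r * r := by
  have hr0 : 0 < r := by linarith
  have h1 := H.mul_rpow_mono one_pos hr
  simp only [Real.one_rpow, mul_one] at h1
  rw [mul_self_eq hr0 gLo h, Real.rpow_add_one hr0.ne', ← mul_assoc]
  have := H.bounds.1.trans h1
  gcongr

lemma intervalIntegrable (H : IsProfile gLo gUp kLo kUp h) (hg : 0 < gLo) {a b : ℝ}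
    (ha : 0 ≤ a) (hb : 0 ≤ b) : IntervalIntegrable (fun ρ => h ρ * ρ) volume a b := by
  apply MonotoneOn.intervalIntegrable
  apply (H.monotoneOn_mul_self hg).mono
  intro x hx
  exact (le_inf ha hb).trans hx.1

lemma prim_mono (H : IsProfile gLo gUp kLo kUp h) (hg : 0 < gLo) {a b : ℝ}
    (ha : 0 ≤ a) (hab : a ≤ b) : prim h a ≤ prim h b := by
  have hb := ha.trans hab
  have := intervalIntegral.integral_add_adjacent_intervals
    (H.intervalIntegrable hg le_rfl ha) (H.intervalIntegrable hg ha hb)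
  have h2 : 0 ≤ ∫ ρ in a..b, h ρ * ρ :=
    intervalIntegral.integral_nonneg hab fun x hx => H.mul_self_nonneg (ha.trans hx.1)
  unfold prim
  linarith

lemma prim_nonneg (H : IsProfile gLo gUp kLo kUp h) (hg : 0 < gLo) {a : ℝ} (ha : 0 ≤ a) :
    0 ≤ prim h a := by
  simpa [prim_zero] using H.prim_mono hg le_rfl ha

lemma prim_le (H : IsProfile gLo gUp kLo kUp h) (hg : 0 < gLo) {r : ℝ} (hr : 0 ≤ r) :
    prim h r ≤ h r * r * r := by
  have := intervalIntegral.integral_mono_on hr (H.intervalIntegrable hg le_rfl hr)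
    (intervalIntegrable_const (c := h r * r)) fun x hx =>
      H.monotoneOn_mul_self hg (mem_Ici.2 hx.1) (mem_Ici.2 hr) hx.2
  simp only [intervalIntegral.integral_const, sub_zero, smul_eq_mul] at this
  unfold prim
  linarith

/-- On [r/2, r] the increasing integrand is at least its value at r/2, and doubling
(`mul_self_scale` with factor 2) compares that value with the one at r. -/
lemma mul_le_prim (H : IsProfile gLo gUp kLo kUp h) (hg : 0 < gLo) {r : ℝ} (hr : 0 ≤ r) :
    h r * r * r ≤ 2 ^ (gUp + 1) * prim h r := by
  have hr2 : 0 ≤ r / 2 := by positivity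
  have h1 := intervalIntegral.integral_mono_on (half_le_self hr)
    (intervalIntegrable_const (c := h (r / 2) * (r / 2))) (H.intervalIntegrable hg hr2 hr)
    fun x hx => H.monotoneOn_mul_self hg (mem_Ici.2 hr2) (mem_Ici.2 (hr2.trans hx.1)) hx.1
  have h2 := intervalIntegral.integral_add_adjacent_intervals
    (H.intervalIntegrable hg le_rfl hr2) (H.intervalIntegrable hg hr2 hr)
  have h3 := H.prim_nonneg hg hr2
  have h4 := H.mul_self_scale one_le_two hr2
  rw [mul_div_cancel₀ r two_ne_zero] at h4
  simp only [intervalIntegral.integral_const, smul_eq_mul] at h1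
  rw [Real.rpow_add_one two_ne_zero]
  have h5 : r / 2 * (h (r / 2) * (r / 2)) ≤ prim h r := by
    unfold prim at *
    linarith
  have h6 : (0 : ℝ) < 2 ^ gUp := by positivity
  nlinarith [mul_le_mul_of_nonneg_right h4 hr, mul_le_mul_of_nonneg_left h5 h6.le]

/-- Serves as convexity of the primitive, up to a constant: `prim h r` is comparable to h(r) r², and
in h(cr)(cr)·(cr) monotonicity removes c from the first factor only. -/
lemma prim_small_scale (H : IsProfile gLo gUp kLo kUp h) (hg : 0 < gLo) {c r : ℝ}
    (hc : 0 ≤ c) (hc1 : c ≤ 1) (hr : 0 ≤ r) :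
    prim h (c * r) ≤ c * (2 ^ (gUp + 1) * prim h r) := by
  have hcr : 0 ≤ c * r := by positivity
  have h1 := H.prim_le hg hcr
  have h2 := H.monotoneOn_mul_self hg (mem_Ici.2 hcr) (mem_Ici.2 hr) (by nlinarith)
  have h3 := H.mul_le_prim hg hr
  simp only at h2
  calc prim h (c * r) ≤ h (c * r) * (c * r) * (c * r) := h1
    _ ≤ h r * r * (c * r) := by gcongr
    _ = c * (h r * r * r) := by ring
    _ ≤ _ := by gcongr

lemma prim_large_scale (H : IsProfile gLo gUp kLo kUp h) (hg : 0 < gLo) {C r : ℝ}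
    (hC : 1 ≤ C) (hr : 0 ≤ r) :
    prim h (C * r) ≤ C ^ gUp * C * (2 ^ (gUp + 1) * prim h r) := by
  have hC0 : 0 ≤ C := by linarith
  have hcr : 0 ≤ C * r := by positivity
  calc prim h (C * r) ≤ h (C * r) * (C * r) * (C * r) := H.prim_le hg hcr
    _ ≤ C ^ gUp * (h r * r) * (C * r) :=
        mul_le_mul_of_nonneg_right (H.mul_self_scale hC hr) hcr
    _ = C ^ gUp * C * (h r * r * r) := by ring
    _ ≤ _ := mul_le_mul_of_nonneg_left (H.mul_le_prim hg hr) (by positivity)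

lemma prim_add_le (H : IsProfile gLo gUp kLo kUp h) (hg : 0 < gLo) {a b c : ℝ}
    (hc : 0 ≤ c) (ha : 0 ≤ a) (hb : 0 ≤ b) (h' : c ≤ a + b) :
    prim h c ≤ prim h (2 * a) + prim h (2 * b) := by
  rcases le_total a b with hab | hab
  · have := H.prim_mono hg hc (b := 2 * b) (by linarith)
    have := H.prim_nonneg hg (a := 2 * a) (by linarith)
    linarith
  · have := H.prim_mono hg hc (b := 2 * a) (by linarith)
    have := H.prim_nonneg hg (a := 2 * b) (by linarith)
    linarith

lemma prim_pos (H : IsProfile gLo gUp kLo kUp h) (hg : 0 < gLo) {r : ℝ} (hr : 0 < r) :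
    0 < prim h r := by
  have h1 := H.mul_le_prim hg hr.le
  have h2 : 0 < h r * r * r := by have := H.pos r hr; positivity
  have h3 : (0 : ℝ) < 2 ^ (gUp + 1) := by positivity
  exact pos_of_mul_pos_right (h2.trans_le h1) h3.le

lemma tendsto_zero_of_prim (H : IsProfile gLo gUp kLo kUp h) (hg : 0 < gLo) {r : ℕ → ℝ}
    (hr : ∀ n, 0 ≤ r n) (hp : Tendsto (fun n => prim h (r n)) atTop (𝓝 0)) :
    Tendsto r atTop (𝓝 0) := by
  rw [Metric.tendsto_atTop]
  intro ε hε
  have := hp.eventually (gt_mem_nhds (H.prim_pos hg hε))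
  obtain ⟨N, hN⟩ := eventually_atTop.1 this
  refine ⟨N, fun n hn => ?_⟩
  rw [Real.dist_eq, sub_zero, abs_of_nonneg (hr n)]
  by_contra! hc
  exact absurd (hN n hn) (not_lt.2 (H.prim_mono hg hε.le hc))

lemma tendsto_prim_zero (H : IsProfile gLo gUp kLo kUp h) (hg : 0 < gLo) {r : ℕ → ℝ}
    (hr : ∀ n, 0 ≤ r n) (hp : Tendsto r atTop (𝓝 0)) :
    Tendsto (fun n => prim h (r n)) atTop (𝓝 0) := by
  have h1 : Tendsto (fun n => r n * (2 ^ (gUp + 1) * prim h 1)) atTop (𝓝 0) := by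
    simpa using hp.mul_const (2 ^ (gUp + 1) * prim h 1)
  refine tendsto_of_tendsto_of_tendsto_of_le_of_le' tendsto_const_nhds h1
    (Eventually.of_forall fun n => H.prim_nonneg hg (hr n)) ?_
  filter_upwards [hp.eventually (gt_mem_nhds one_pos)] with n hn
  simpa using H.prim_small_scale hg (hr n) hn.le zero_le_one

end IsProfile

end FracOrlicz

/-! ### Smooth truncations -/

namespace FracOrlicz

/-- Smooth truncations between the heights `k` and `k + t`, with a universal loss `θ`. -/
structure IsTruncation (θ k t : ℝ) (T : ℝ → ℝ) : Prop where
  contDiff : ContDiff ℝ ∞ T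
  monotone : Monotone T
  lipschitz : LipschitzWith 1 T
  eq_zero : ∀ r, |r| ≤ k → T r = 0
  abs_le : ∀ r, |T r| ≤ θ * t
  abs_eq : ∀ r, k + t ≤ |r| → |T r| = θ * t

/-- A C¹ function is Lipschitz on the compact [0, 1], and the transition factors through the
projection onto that interval, which is a contraction. -/
lemma exists_lipschitzWith_smoothTransition :
    ∃ K : ℝ≥0, LipschitzWith K Real.smoothTransition := by
  obtain ⟨K, hK⟩ := (Real.smoothTransition.contDiff (n := 1)).contDiffOn.exists_lipschitzOnWith
    one_ne_zero (convex_Icc (0 : ℝ) 1) isCompact_Icc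
  refine ⟨K, LipschitzWith.of_dist_le_mul fun x y => ?_⟩
  rw [← Real.smoothTransition.projIcc (x := x), ← Real.smoothTransition.projIcc (x := y)]
  refine (hK.dist_le_mul _ (projIcc 0 1 zero_le_one x).2 _ (projIcc 0 1 zero_le_one y).2).trans ?_
  gcongr
  have := (LipschitzWith.projIcc (zero_le_one (α := ℝ))).dist_le_mul x y
  rwa [NNReal.coe_one, one_mul] at this

lemma exists_isTruncation :
    ∃ θ : ℝ, 0 < θ ∧ ∀ k t : ℝ, 0 ≤ k → 0 < t → ∃ T, IsTruncation θ k t T := by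
  obtain ⟨K, hK⟩ := exists_lipschitzWith_smoothTransition
  have hK0 : (0 : ℝ) ≤ K := K.2
  -- Each of the two transitions below has Lipschitz constant K/t, and the prefactor is θt; so θ·2K
  -- ≤ 1 is needed, and the + 1 keeps the denominator positive.
  refine ⟨1 / (2 * K + 1), by positivity, fun k t hk ht => ?_⟩
  set θ : ℝ := 1 / (2 * K + 1) with hθ
  have hθ0 : 0 < θ := by positivity
  have hθK : θ * (2 * K) ≤ 1 := by
    rw [hθ, one_div_mul_eq_div, div_le_one (by positivity)]
    linarith
  set S := Real.smoothTransition
  have S0 : ∀ x, 0 ≤ S x := Real.smoothTransition.nonneg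
  have S1 : ∀ x, S x ≤ 1 := Real.smoothTransition.le_one
  refine ⟨fun r => θ * t * (S ((r - k) / t) - S ((-r - k) / t)), ?_, ?_, ?_, ?_, ?_, ?_⟩
  · have h : ContDiff ℝ ∞ S := Real.smoothTransition.contDiff
    exact contDiff_const.mul
      ((h.comp (by fun_prop)).sub (h.comp (by fun_prop)))
  · intro a b hab
    have h1 : S ((a - k) / t) ≤ S ((b - k) / t) := Real.smoothTransition.monotone (by gcongr)
    have h2 : S ((-b - k) / t) ≤ S ((-a - k) / t) := Real.smoothTransition.monotone (by gcongr)
    simp only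
    gcongr
  · refine LipschitzWith.of_dist_le_mul fun a b => ?_
    have h1 := hK.dist_le_mul ((a - k) / t) ((b - k) / t)
    have h2 := hK.dist_le_mul ((-a - k) / t) ((-b - k) / t)
    rw [Real.dist_eq, Real.dist_eq] at h1 h2
    have e1 : |(a - k) / t - (b - k) / t| = |a - b| / t := by
      rw [← sub_div, abs_div, abs_of_pos ht]; congr 2; ring
    have e2 : |(-a - k) / t - (-b - k) / t| = |a - b| / t := by
      rw [← sub_div, abs_div, abs_of_pos ht, abs_sub_comm a b]; congr 2; ring
    rw [e1] at h1
    rw [e2] at h2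
    rw [Real.dist_eq, Real.dist_eq, NNReal.coe_one, one_mul, ← mul_sub, abs_mul,
      abs_of_pos (by positivity : 0 < θ * t)]
    have h3 : |S ((a - k) / t) - S ((-a - k) / t) - (S ((b - k) / t) - S ((-b - k) / t))|
        ≤ 2 * (K * (|a - b| / t)) := by
      calc _ = |(S ((a - k) / t) - S ((b - k) / t))
              - (S ((-a - k) / t) - S ((-b - k) / t))| := by congr 1; ring
        _ ≤ _ := abs_sub _ _
        _ ≤ _ := by linarith
    calc _ ≤ θ * t * (2 * (K * (|a - b| / t))) := by gcongr
      _ = θ * (2 * K) * |a - b| := by field_simp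
      _ ≤ 1 * |a - b| := by gcongr
      _ = _ := one_mul _
  · intro r hr
    have := abs_le.1 hr
    have h1 : S ((r - k) / t) = 0 :=
      Real.smoothTransition.zero_of_nonpos (div_nonpos_of_nonpos_of_nonneg (by linarith) ht.le)
    have h2 : S ((-r - k) / t) = 0 :=
      Real.smoothTransition.zero_of_nonpos (div_nonpos_of_nonpos_of_nonneg (by linarith) ht.le)
    simp [h1, h2]
  · intro r
    rw [abs_mul, abs_of_pos (by positivity : 0 < θ * t)]
    refine mul_le_of_le_one_right (by positivity) (abs_le.2 ⟨?_, ?_⟩)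
    · linarith [S0 ((r - k) / t), S1 ((-r - k) / t)]
    · linarith [S1 ((r - k) / t), S0 ((-r - k) / t)]
  · intro r hr
    rw [abs_mul, abs_of_pos (by positivity : 0 < θ * t)]
    rcases le_abs.1 hr with hr | hr
    · have h1 : S ((r - k) / t) = 1 :=
        Real.smoothTransition.one_of_one_le ((one_le_div ht).2 (by linarith))
      have h2 : S ((-r - k) / t) = 0 :=
        Real.smoothTransition.zero_of_nonpos (div_nonpos_of_nonpos_of_nonneg (by linarith) ht.le)
      simp [h1, h2]
    · have h1 : S ((r - k) / t) = 0 :=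
        Real.smoothTransition.zero_of_nonpos (div_nonpos_of_nonpos_of_nonneg (by linarith) ht.le)
      have h2 : S ((-r - k) / t) = 1 :=
        Real.smoothTransition.one_of_one_le ((one_le_div ht).2 (by linarith))
      simp [h1, h2]

lemma IsTestFunction.comp {d : ℕ} {Ω : Set (Sp d)} {φ : Sp d → ℝ} (hφ : IsTestFunction Ω φ)
    {T : ℝ → ℝ} (hT : ContDiff ℝ ∞ T) (hT0 : T 0 = 0) : IsTestFunction Ω (fun x => T (φ x)) where
  contDiff := hT.comp hφ.contDiff
  hasCompactSupport := hφ.hasCompactSupport.comp_left hT0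
  tsupport_subset := (closure_mono (Function.support_comp_subset hT0 φ)).trans hφ.tsupport_subset

/-! ### Joint measurability of the primitive -/

section Measurability

variable {d : ℕ} {g : Sp d → Sp d → ℝ → ℝ}

lemma measurable_prim_abs
    (hg : Measurable (fun z : Sp d × Sp d × ℝ => g z.1 z.2.1 z.2.2)) :
    Measurable (fun z : Sp d × Sp d × ℝ => prim (g z.1 z.2.1) |z.2.2|) := by
  have h1 : Measurable (fun q : (Sp d × Sp d × ℝ) × ℝ =>
      {q : (Sp d × Sp d × ℝ) × ℝ | 0 < q.2 ∧ q.2 ≤ |q.1.2.2|}.indicator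
        (fun q => g q.1.1 q.1.2.1 q.2 * q.2) q) := by
    apply Measurable.indicator
    · exact (hg.comp (by fun_prop :
        Measurable fun q : (Sp d × Sp d × ℝ) × ℝ => (q.1.1, q.1.2.1, q.2))).mul measurable_snd
    · exact (measurableSet_lt measurable_const measurable_snd).inter
        (measurableSet_le measurable_snd (by fun_prop))
  have h2 := (h1.stronglyMeasurable.integral_prod_right' (ν := volume)).measurable
  convert h2 using 2 with z
  rw [prim, intervalIntegral.integral_of_le (abs_nonneg _),
    ← integral_indicator measurableSet_Ioc]
  congr 1

lemma aemeasurable_prim_pair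
    (hg : Measurable (fun z : Sp d × Sp d × ℝ => g z.1 z.2.1 z.2.2)) {w : Sp d × Sp d → ℝ}
    (hw : AEMeasurable w) : AEMeasurable (fun z => prim (g z.1 z.2) |w z|) :=
  (measurable_prim_abs hg).comp_aemeasurable
    (measurable_fst.aemeasurable.prodMk (measurable_snd.aemeasurable.prodMk hw))

lemma aemeasurable_prim_diag
    (hg : Measurable (fun z : Sp d × Sp d × ℝ => g z.1 z.2.1 z.2.2)) {w : Sp d → ℝ}
    (hw : AEMeasurable w) : AEMeasurable (fun x => prim (g x x) |w x|) :=
  (measurable_prim_abs hg).comp_aemeasurable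
    (aemeasurable_id'.prodMk (aemeasurable_id'.prodMk hw))

lemma aemeasurable_diffQuot {s : ℝ} {u : Sp d → ℝ} (hu : AEMeasurable u) :
    AEMeasurable (fun z : Sp d × Sp d => diffQuot s u z.1 z.2) := by
  unfold diffQuot
  exact (hu.comp_fst.sub hu.comp_snd).div (by fun_prop)

end Measurability

end FracOrlicz

/-! ### Convergence in modular for weighted families of profiles -/

namespace FracOrlicz

section Abstract

variable {X : Type*} [MeasurableSpace X] {μ : Measure X}

lemma ae_tendsto_zero_of_tsum_lintegral {A : ℕ → X → ℝ≥0∞} (hA : ∀ n, AEMeasurable (A n) μ)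
    (hs : ∑' n, ∫⁻ x, A n x ∂μ ≠ ⊤) : ∀ᵐ x ∂μ, Tendsto (fun n => A n x) atTop (𝓝 0) := by
  rw [← lintegral_tsum hA] at hs
  filter_upwards [ae_lt_top' (AEMeasurable.tsum hA) hs] with x hx
  exact ENNReal.tendsto_atTop_zero_of_tsum_ne_top hx.ne

/-- Summability of the integrals of the `A n` makes their sum an integrable majorant, so dominated
convergence applies to the whole sequence. -/
lemma tendsto_lintegral_zero_of_le_add {F A : ℕ → X → ℝ≥0∞} {B : X → ℝ≥0∞}
    (hF : ∀ n, AEMeasurable (F n) μ) (hA : ∀ n, AEMeasurable (A n) μ) (hB : AEMeasurable B μ)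
    (hle : ∀ n, ∀ᵐ x ∂μ, F n x ≤ A n x + B x)
    (hs : ∑' n, ∫⁻ x, A n x ∂μ ≠ ⊤) (hBi : ∫⁻ x, B x ∂μ ≠ ⊤)
    (h0 : ∀ᵐ x ∂μ, Tendsto (fun n => F n x) atTop (𝓝 0)) :
    Tendsto (fun n => ∫⁻ x, F n x ∂μ) atTop (𝓝 0) := by
  have := tendsto_lintegral_of_dominated_convergence' (μ := μ) (F := F) (f := fun _ => 0)
    (fun x => ∑' n, A n x + B x) hF ?_ ?_ h0
  · simpa using this
  · intro n
    filter_upwards [hle n] with x hx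
    exact hx.trans (by gcongr; exact ENNReal.le_tsum n)
  · rw [lintegral_add_right' _ hB, lintegral_tsum hA]
    exact ENNReal.add_ne_top.2 ⟨hs, hBi⟩

/-- The modular of `w` for the profiles `H z`, `z ∈ X`, with a weight. -/
noncomputable def wmod (μ : Measure X) (ρ : X → ℝ≥0∞) (H : X → ℝ → ℝ) (w : X → ℝ) : ℝ≥0∞ :=
  ∫⁻ z, ENNReal.ofReal (prim (H z) |w z|) * ρ z ∂μ

variable {ρ : X → ℝ≥0∞} {H : X → ℝ → ℝ} {gLo gUp kLo kUp : ℝ}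

lemma wmod_mono (hH : ∀ᵐ z ∂μ, IsProfile gLo gUp kLo kUp (H z)) (hg : 0 < gLo) {v w : X → ℝ}
    (hvw : ∀ z, |v z| ≤ |w z|) : wmod μ ρ H v ≤ wmod μ ρ H w := by
  refine lintegral_mono_ae ?_
  filter_upwards [hH] with z hz
  gcongr
  exact hz.prim_mono hg (abs_nonneg _) (hvw z)

lemma wmod_const_mul_lt_top (hH : ∀ᵐ z ∂μ, IsProfile gLo gUp kLo kUp (H z)) (hg : 0 < gLo)
    {w : X → ℝ} (hw : wmod μ ρ H w < ⊤) {C : ℝ} (hC : 1 ≤ C) :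
    wmod μ ρ H (fun z => C * w z) < ⊤ := by
  have hC0 : 0 < C := by linarith
  refine lt_of_le_of_lt ?_
    (ENNReal.mul_lt_top (ENNReal.ofReal_lt_top (r := C ^ gUp * C * 2 ^ (gUp + 1))) hw)
  rw [wmod, wmod, ← lintegral_const_mul' _ _ ENNReal.ofReal_ne_top]
  refine lintegral_mono_ae ?_
  filter_upwards [hH] with z hz
  rw [← mul_assoc, ← ENNReal.ofReal_mul (by positivity), abs_mul, abs_of_pos hC0]
  gcongr
  have := hz.prim_large_scale hg hC (abs_nonneg (w z))
  linarith

lemma wmod_div_le (hH : ∀ᵐ z ∂μ, IsProfile gLo gUp kLo kUp (H z)) (hg : 0 < gLo)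
    {w : X → ℝ} {c l m : ℝ} (hc0 : 0 ≤ c) (hc : c ≤ 1) (hl : 0 < l) (hm : 0 < m) (hml : m ≤ c * l)
    (hw : wmod μ ρ H (fun z => w z / m) ≤ 1) :
    wmod μ ρ H (fun z => w z / l) ≤ ENNReal.ofReal c * ENNReal.ofReal (2 ^ (gUp + 1)) := by
  rw [← ENNReal.ofReal_mul hc0]
  refine le_trans ?_ (mul_le_of_le_one_right' hw)
  rw [wmod, wmod, ← lintegral_const_mul' _ _ ENNReal.ofReal_ne_top]
  refine lintegral_mono_ae ?_
  filter_upwards [hH] with z hz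
  rw [← mul_assoc, ← ENNReal.ofReal_mul (by positivity)]
  gcongr
  have h1 : |w z / l| ≤ c * |w z / m| := by
    rw [abs_div, abs_div, abs_of_pos hl, abs_of_pos hm, ← mul_div_assoc, div_le_div_iff₀ hl hm]
    nlinarith [abs_nonneg (w z)]
  refine (hz.prim_mono hg (abs_nonneg _) h1).trans ?_
  have := hz.prim_small_scale hg hc0 hc (abs_nonneg (w z / m))
  linarith

lemma wmod_tsum_ne_top (hH : ∀ᵐ z ∂μ, IsProfile gLo gUp kLo kUp (H z)) (hg : 0 < gLo)
    {e : ℕ → X → ℝ} {m : ℕ → ℝ} {l : ℝ} (hl : 0 < l) (hm : ∀ n, 0 < m n)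
    (hml : ∀ n, m n ≤ (1 / 2) ^ n * l) (he : ∀ n, wmod μ ρ H (fun z => e n z / m n) ≤ 1) :
    ∑' n, wmod μ ρ H (fun z => e n z / l) ≠ ⊤ := by
  have h1 : ∀ n, wmod μ ρ H (fun z => e n z / l)
      ≤ ENNReal.ofReal ((1 / 2) ^ n) * ENNReal.ofReal (2 ^ (gUp + 1)) := fun n =>
    wmod_div_le hH hg (by positivity) (pow_le_one₀ (by norm_num) (by norm_num)) hl (hm n)
      (hml n) (he n)
  refine ne_top_of_le_ne_top ?_ (ENNReal.tsum_le_tsum h1)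
  rw [ENNReal.tsum_mul_right]
  refine ENNReal.mul_ne_top ?_ ENNReal.ofReal_ne_top
  rw [← ENNReal.ofReal_tsum_of_nonneg (fun n => by positivity) summable_geometric_two]
  exact ENNReal.ofReal_ne_top

lemma ae_tendsto_zero_of_wmod (hH : ∀ᵐ z ∂μ, IsProfile gLo gUp kLo kUp (H z)) (hg : 0 < gLo)
    (hρ : AEMeasurable ρ μ) (hρ0 : ∀ z, ρ z ≠ 0)
    (hmeas : ∀ w : X → ℝ, AEMeasurable w μ → AEMeasurable (fun z => prim (H z) |w z|) μ)
    {e : ℕ → X → ℝ} (hem : ∀ n, AEMeasurable (e n) μ) {m : ℕ → ℝ} {l : ℝ} (hl : 0 < l)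
    (hm : ∀ n, 0 < m n) (hml : ∀ n, m n ≤ (1 / 2) ^ n * l)
    (he : ∀ n, wmod μ ρ H (fun z => e n z / m n) ≤ 1) :
    ∀ᵐ z ∂μ, Tendsto (fun n => e n z) atTop (𝓝 0) := by
  have h1 := ae_tendsto_zero_of_tsum_lintegral
    (A := fun n z => ENNReal.ofReal (prim (H z) |e n z / l|) * ρ z)
    (fun n => (hmeas _ ((hem n).div_const l)).ennreal_ofReal.mul hρ)
    (wmod_tsum_ne_top hH hg hl hm hml he)
  filter_upwards [h1, hH] with z hz hHz
  have h2 : Tendsto (fun n => ENNReal.ofReal (prim (H z) |e n z / l|)) atTop (𝓝 0) := by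
    -- The weight |x - y|^(-d) can be infinite on the diagonal; where it is, convergence to 0 of the
    -- products forces the other factor to vanish eventually.
    by_cases hT : ρ z = ⊤
    · refine tendsto_const_nhds.congr' ?_
      filter_upwards [hz.eventually (gt_mem_nhds ENNReal.zero_lt_top)] with n hn
      by_contra hne
      rw [hT, ENNReal.mul_top (Ne.symm hne)] at hn
      exact lt_irrefl _ hn
    · have := ENNReal.Tendsto.mul_const hz (b := (ρ z)⁻¹) (Or.inr (ENNReal.inv_ne_top.2 (hρ0 z)))
      rw [zero_mul] at this
      refine this.congr fun n => ?_
      rw [mul_assoc, ENNReal.mul_inv_cancel (hρ0 z) hT, mul_one]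
  have h3 : Tendsto (fun n => prim (H z) |e n z / l|) atTop (𝓝 0) := by
    have := (ENNReal.tendsto_toReal ENNReal.zero_ne_top).comp h2
    refine (this.congr fun n => ?_)
    exact ENNReal.toReal_ofReal (hHz.prim_nonneg hg (abs_nonneg _))
  have h4 := hHz.tendsto_zero_of_prim hg (fun n => abs_nonneg _) h3
  have h5 := ((tendsto_zero_iff_abs_tendsto_zero _).2 h4).mul_const l
  rw [zero_mul] at h5
  exact h5.congr fun n => div_mul_cancel₀ _ hl.ne'

/-- Meant for w = u, e = u - φₙ, q = T(u) - T(φₙ), or their difference quotients. The hypothesis on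
the points of infinite weight covers the diagonal, where difference quotients are 0. -/
lemma tendsto_wmod_zero (hH : ∀ᵐ z ∂μ, IsProfile gLo gUp kLo kUp (H z)) (hg : 0 < gLo)
    (hρ : AEMeasurable ρ μ) 
    (hmeas : ∀ w : X → ℝ, AEMeasurable w μ → AEMeasurable (fun z => prim (H z) |w z|) μ)
    {e q : ℕ → X → ℝ} (hρT : ∀ z, ρ z = ⊤ → ∀ n, q n z = 0) {w : X → ℝ}
    (hem : ∀ n, AEMeasurable (e n) μ) (hqm : ∀ n, AEMeasurable (q n) μ) (hwm : AEMeasurable w μ)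
    {m : ℕ → ℝ} {l : ℝ} (hl : 0 < l)
    (hm : ∀ n, 0 < m n) (hml : ∀ n, m n ≤ (1 / 2) ^ n * (l / 2))
    (he : ∀ n, wmod μ ρ H (fun z => e n z / m n) ≤ 1) (hw : wmod μ ρ H w < ⊤)
    (hq : ∀ n z, |q n z| ≤ |e n z| + 2 * |w z|)
    (hq0 : ∀ᵐ z ∂μ, Tendsto (fun n => q n z) atTop (𝓝 0)) :
    Tendsto (fun n => wmod μ ρ H (fun z => q n z / l)) atTop (𝓝 0) := by
  have hl2 : 0 < l / 2 := by positivity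
  -- In 4/l one factor 2 comes from the bound on q and one from `prim_add_le`; the maximum with 1
  -- meets the requirement of `wmod_const_mul_lt_top`.
  have hCl : 1 ≤ max 1 (4 / l) := le_max_left _ _
  have hint : ∀ v : X → ℝ, AEMeasurable v μ →
      AEMeasurable (fun z => ENNReal.ofReal (prim (H z) |v z|) * ρ z) μ :=
    fun v hv => (hmeas v hv).ennreal_ofReal.mul hρ
  refine tendsto_lintegral_zero_of_le_add
    (A := fun n z => ENNReal.ofReal (prim (H z) |e n z / (l / 2)|) * ρ z)
    (B := fun z => ENNReal.ofReal (prim (H z) |max 1 (4 / l) * w z|) * ρ z)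
    (fun n => hint _ ((hqm n).div_const l)) (fun n => hint _ ((hem n).div_const _))
    (hint _ (hwm.const_mul _)) (fun n => ?_) (wmod_tsum_ne_top hH hg hl2 hm hml he)
    (wmod_const_mul_lt_top hH hg hw hCl).ne ?_
  · filter_upwards [hH] with z hz
    rw [← add_mul, ← ENNReal.ofReal_add (hz.prim_nonneg hg (abs_nonneg _))
      (hz.prim_nonneg hg (abs_nonneg _))]
    gcongr
    have h1 : |q n z / l| ≤ |e n z / l| + 2 * |w z| / l := by
      rw [abs_div, abs_div, abs_of_pos hl, ← add_div]
      gcongr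
      exact hq n z
    refine (hz.prim_add_le hg (abs_nonneg _) (abs_nonneg _) (by positivity) h1).trans
      (add_le_add ?_ ?_)
    · refine hz.prim_mono hg (by positivity) (le_of_eq ?_)
      rw [abs_div, abs_div, abs_of_pos hl, abs_of_pos hl2]
      field_simp
    · refine hz.prim_mono hg (by positivity) ?_
      rw [abs_mul, abs_of_pos (zero_lt_one.trans_le hCl)]
      calc 2 * (2 * |w z| / l) = 4 / l * |w z| := by ring
        _ ≤ _ := by gcongr; exact le_max_right _ _
  · filter_upwards [hH, hq0] with z hz hqz
    by_cases hρz : ρ z = ⊤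
    · simp [hρT z hρz, prim_zero]
    have h1 : Tendsto (fun n => |q n z / l|) atTop (𝓝 0) := by
      simpa using (hqz.div_const l).abs
    have h2 := ENNReal.tendsto_ofReal (hz.tendsto_prim_zero hg (fun n => abs_nonneg _) h1)
    have h3 := ENNReal.Tendsto.mul_const h2 (b := ρ z) (Or.inr hρz)
    simpa using h3

end Abstract

end FracOrlicz

/-! ### Stability of W₀ under smooth contractions -/

namespace FracOrlicz

variable {d : ℕ} {s : ℝ} {g : Sp d → Sp d → ℝ → ℝ} {Ω : Set (Sp d)}

lemma luxemburg_le {Γ : (Sp d → ℝ) → ℝ≥0∞} {w : Sp d → ℝ} {l : ℝ} (hl : 0 < l)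
    (h : Γ (fun x => w x / l) ≤ 1) : luxemburg Γ w ≤ ENNReal.ofReal l :=
  sInf_le ⟨l, ⟨hl, h⟩, rfl⟩

lemma exists_of_luxemburg_lt {Γ : (Sp d → ℝ) → ℝ≥0∞} {w : Sp d → ℝ} {l : ℝ}
    (h : luxemburg Γ w < ENNReal.ofReal l) : ∃ m, 0 < m ∧ m ≤ l ∧ Γ (fun x => w x / m) ≤ 1 := by
  obtain ⟨_, ⟨m, ⟨hm, hΓ⟩, rfl⟩, hml⟩ := sInf_lt_iff.1 h
  exact ⟨m, hm, (ENNReal.ofReal_lt_ofReal_iff'.1 hml).1.le, hΓ⟩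

lemma modular_eq_wmod (w : Sp d → ℝ) :
    modular g w = wmod volume (fun _ => 1) (fun x => g x x) w := by
  simp [modular, wmod, primG_eq_prim]

lemma fracModular_eq_wmod (w : Sp d → ℝ) :
    fracModular s g w = wmod volume (fun z => (ENNReal.ofReal (‖z.1 - z.2‖ ^ d))⁻¹)
      (fun z : Sp d × Sp d => g z.1 z.2) (fun z => diffQuot s w z.1 z.2) := by
  simp [fracModular, wmod, primG_eq_prim, div_eq_mul_inv]

lemma diffQuot_div (w : Sp d → ℝ) (l : ℝ) (x y : Sp d) :
    diffQuot s (fun x => w x / l) x y = diffQuot s w x y / l := by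
  unfold diffQuot; ring

lemma diffQuot_sub (v w : Sp d → ℝ) (x y : Sp d) :
    diffQuot s (fun x => v x - w x) x y = diffQuot s v x y - diffQuot s w x y := by
  unfold diffQuot; ring

lemma diffQuot_self (w : Sp d → ℝ) (x : Sp d) : diffQuot s w x x = 0 := by simp [diffQuot]

lemma abs_diffQuot_comp_le {T : ℝ → ℝ} (hT : LipschitzWith 1 T) (w : Sp d → ℝ) (x y : Sp d) :
    |diffQuot s (fun x => T (w x)) x y| ≤ |diffQuot s w x y| := by
  unfold diffQuot
  rw [abs_div, abs_div]
  refine div_le_div_of_nonneg_right ?_ (abs_nonneg _)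
  simpa [Real.dist_eq] using hT.dist_le_mul (w x) (w y)

lemma aemeasurable_weight : AEMeasurable
    (fun z : Sp d × Sp d => (ENNReal.ofReal (‖z.1 - z.2‖ ^ d))⁻¹) := by fun_prop

/-- An approximating sequence of test functions, at the level of the modulars. -/
lemma MemW0.exists_seq {u : Sp d → ℝ} (hu : MemW0 s g Ω u) {l : ℝ} (hl : 0 < l) :
    ∃ (φ : ℕ → Sp d → ℝ) (m m' : ℕ → ℝ), (∀ n, IsTestFunction Ω (φ n)) ∧
      (∀ n, 0 < m n) ∧ (∀ n, m n ≤ (1 / 2) ^ n * l) ∧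
      (∀ n, modular g (fun x => (u x - φ n x) / m n) ≤ 1) ∧
      (∀ n, 0 < m' n) ∧ (∀ n, m' n ≤ (1 / 2) ^ n * l) ∧
      (∀ n, fracModular s g (fun x => (u x - φ n x) / m' n) ≤ 1) := by
  have h : ∀ n : ℕ, ∃ (φ : Sp d → ℝ) (m m' : ℝ), IsTestFunction Ω φ ∧
      0 < m ∧ m ≤ (1 / 2) ^ n * l ∧ modular g (fun x => (u x - φ x) / m) ≤ 1 ∧
      0 < m' ∧ m' ≤ (1 / 2) ^ n * l ∧ fracModular s g (fun x => (u x - φ x) / m') ≤ 1 := by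
    intro n
    obtain ⟨φ, hφ, hlt⟩ := hu.closure (ENNReal.ofReal ((1 / 2) ^ n * l))
      (ENNReal.ofReal_pos.2 (by positivity))
    obtain ⟨m, h1, h2, h3⟩ := exists_of_luxemburg_lt (lt_of_le_of_lt le_self_add hlt)
    obtain ⟨m', h1', h2', h3'⟩ := exists_of_luxemburg_lt (lt_of_le_of_lt le_add_self hlt)
    exact ⟨φ, m, m', hφ, h1, h2, h3, h1', h2', h3'⟩
  choose φ m m' h1 h2 h3 h4 h5 h6 h7 using h
  exact ⟨φ, m, m', h1, h2, h3, h4, h5, h6, h7⟩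

variable {gLo gUp kLo kUp : ℝ}

lemma ae_tendsto_of_modular (hg : IsNonlinearity gLo gUp kLo kUp g) (hgLo : 0 < gLo)
    {u : Sp d → ℝ} (hu : AEMeasurable u) {φ : ℕ → Sp d → ℝ} (hφ : ∀ n, IsTestFunction Ω (φ n))
    {m : ℕ → ℝ} {l : ℝ} (hl : 0 < l) (hm : ∀ n, 0 < m n) (hml : ∀ n, m n ≤ (1 / 2) ^ n * l)
    (he : ∀ n, modular g (fun x => (u x - φ n x) / m n) ≤ 1) :
    ∀ᵐ x, Tendsto (fun n => φ n x) atTop (𝓝 (u x)) := by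
  have h := ae_tendsto_zero_of_wmod hg.ae_profile_diag hgLo aemeasurable_const
    (fun _ => one_ne_zero) (fun w hw => aemeasurable_prim_diag hg.measurable hw)
    (e := fun n x => u x - φ n x)
    (fun n => hu.sub (hφ n).contDiff.continuous.measurable.aemeasurable) hl hm hml
    (fun n => by rw [← modular_eq_wmod]; exact he n)
  filter_upwards [h] with x hx
  simpa using hx.const_sub (u x)

/-- Test functions vanish off Ω, and a fast approximating sequence of them converges to u almost
everywhere. -/
lemma MemW0.ae_eq_zero (hg : IsNonlinearity gLo gUp kLo kUp g) (hgLo : 0 < gLo) {u : Sp d → ℝ}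
    (hu : MemW0 s g Ω u) : ∀ᵐ x, x ∉ Ω → u x = 0 := by
  obtain ⟨φ, m, m', hφ, h1, h2, h3, -⟩ := hu.exists_seq one_pos
  filter_upwards [ae_tendsto_of_modular hg hgLo hu.memW.aestronglyMeasurable.aemeasurable hφ
    one_pos h1 h2 h3] with x hx hxΩ
  refine tendsto_nhds_unique hx (tendsto_const_nhds.congr fun n => ?_)
  by_contra hne
  exact hxΩ ((hφ n).tsupport_subset (subset_tsupport _ (Ne.symm hne)))

lemma MemW.comp (hg : IsNonlinearity gLo gUp kLo kUp g) (hgLo : 0 < gLo) {u : Sp d → ℝ}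
    (hu : MemW s g u) {T : ℝ → ℝ} (hT : LipschitzWith 1 T) (hT0 : T 0 = 0) :
    MemW s g (fun x => T (u x)) where
  aestronglyMeasurable := hT.continuous.comp_aestronglyMeasurable hu.aestronglyMeasurable
  modular_lt_top := by
    refine lt_of_le_of_lt ?_ hu.modular_lt_top
    rw [modular_eq_wmod, modular_eq_wmod]
    refine wmod_mono hg.ae_profile_diag hgLo fun x => ?_
    simpa [Real.dist_eq, hT0] using hT.dist_le_mul (u x) 0
  fracModular_lt_top := by
    refine lt_of_le_of_lt ?_ hu.fracModular_lt_top
    rw [fracModular_eq_wmod, fracModular_eq_wmod]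
    exact wmod_mono hg.ae_profile hgLo fun z => abs_diffQuot_comp_le hT u z.1 z.2

/-- `W₀^{s,G}(Ω)` is stable under composition with smooth contractions vanishing at `0`. -/
lemma MemW0.comp (hg : IsNonlinearity gLo gUp kLo kUp g) (hgLo : 0 < gLo) {u : Sp d → ℝ}
    (hu : MemW0 s g Ω u) {T : ℝ → ℝ} (hTs : ContDiff ℝ ∞ T) (hT : LipschitzWith 1 T)
    (hT0 : T 0 = 0) : MemW0 s g Ω (fun x => T (u x)) where
  memW := hu.memW.comp hg hgLo hT hT0
  closure := by
    intro ε hε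
    obtain ⟨δ, hδ0, hδε⟩ := ENNReal.lt_iff_exists_nnreal_btwn.1 hε
    have hδ : (0 : ℝ) < δ := by exact_mod_cast hδ0
    -- The norm is a sum of two Luxemburg functionals; each gets half of δ.
    set l : ℝ := δ / 2 with hl_def
    have hl : 0 < l := by positivity
    have hl2 : 0 < l / 2 := by positivity
    obtain ⟨φ, m, m', hφ, h1, h2, h3, h1', h2', h3'⟩ := hu.exists_seq hl2
    have hum := hu.memW.aestronglyMeasurable.aemeasurable
    have hφm : ∀ n, AEMeasurable (φ n) := fun n => (hφ n).contDiff.continuous.aemeasurable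
    have hTum : AEMeasurable (fun x => T (u x)) := hT.continuous.measurable.comp_aemeasurable hum
    have hTφm : ∀ n, AEMeasurable (fun x => T (φ n x)) := fun n =>
      hT.continuous.measurable.comp_aemeasurable (hφm n)
    have hlim : ∀ᵐ x, Tendsto (fun n => T (u x) - T (φ n x)) atTop (𝓝 0) := by
      filter_upwards [ae_tendsto_of_modular hg hgLo hum hφ hl2 h1 h2 h3] with x hx
      simpa using ((hT.continuous.tendsto _).comp hx).const_sub (T (u x))
    have hA : Tendsto (fun n => modular g (fun x => (T (u x) - T (φ n x)) / l)) atTop (𝓝 0) := by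
      simp_rw [modular_eq_wmod] at h3 ⊢
      refine tendsto_wmod_zero hg.ae_profile_diag hgLo aemeasurable_const
        (fun w hw => aemeasurable_prim_diag hg.measurable hw) (e := fun n x => u x - φ n x)
        (q := fun n x => T (u x) - T (φ n x)) (w := u) (by simp)
        (fun n => hum.sub (hφm n)) (fun n => hTum.sub (hTφm n)) hum hl h1 h2 h3
        (by rw [← modular_eq_wmod]; exact hu.memW.modular_lt_top) (fun n x => ?_) hlim
      have := hT.dist_le_mul (u x) (φ n x)
      rw [Real.dist_eq, Real.dist_eq, NNReal.coe_one, one_mul] at this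
      linarith [abs_nonneg (u x)]
    have hB : Tendsto (fun n => fracModular s g (fun x => (T (u x) - T (φ n x)) / l))
        atTop (𝓝 0) := by
      simp_rw [fracModular_eq_wmod, diffQuot_div] at h3' ⊢
      refine tendsto_wmod_zero hg.ae_profile hgLo aemeasurable_weight
        (fun w hw => aemeasurable_prim_pair hg.measurable hw)
        (e := fun n z => diffQuot s (fun x => u x - φ n x) z.1 z.2)
        (q := fun n z => diffQuot s (fun x => T (u x) - T (φ n x)) z.1 z.2)
        (w := fun z => diffQuot s u z.1 z.2) ?_
        (fun n => aemeasurable_diffQuot (hum.sub (hφm n)))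
        (fun n => aemeasurable_diffQuot (hTum.sub (hTφm n))) (aemeasurable_diffQuot hum)
        hl h1' h2' h3'
        (by rw [← fracModular_eq_wmod]; exact hu.memW.fracModular_lt_top) (fun n z => ?_) ?_
      · rintro ⟨x, y⟩ hz n
        have hxy : x = y := by
          by_contra hne
          have : 0 < ‖x - y‖ := norm_pos_iff.2 (sub_ne_zero.2 hne)
          rw [ENNReal.inv_eq_top, ENNReal.ofReal_eq_zero] at hz
          exact absurd hz (not_le.2 (by positivity))
        subst hxy
        exact diffQuot_self _ _
      -- The difference quotient of T(u) - T(φₙ) is not controlled by that of u - φₙ alone. The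
      -- triangle inequality bounds it by |δu| + |δφₙ| ≤ |δ(u - φₙ)| + 2|δu|, which suffices for
      -- domination; smallness comes from a.e. convergence.
      · rw [diffQuot_sub]
        have e1 := abs_diffQuot_comp_le (s := s) hT u z.1 z.2
        have e2 := abs_diffQuot_comp_le (s := s) hT (φ n) z.1 z.2
        have e3 : diffQuot s (φ n) z.1 z.2
            = diffQuot s u z.1 z.2 - diffQuot s (fun x => u x - φ n x) z.1 z.2 := by
          rw [diffQuot_sub]; ring
        have e4 : |diffQuot s (φ n) z.1 z.2| ≤ _ := e3 ▸ abs_sub _ _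
        have e5 := abs_sub (diffQuot s (fun x => T (u x)) z.1 z.2)
          (diffQuot s (fun x => T (φ n x)) z.1 z.2)
        linarith
      · filter_upwards [Measure.quasiMeasurePreserving_fst.ae hlim,
          Measure.quasiMeasurePreserving_snd.ae hlim] with z hz1 hz2
        simpa [diffQuot] using (hz1.sub hz2).div_const (‖z.1 - z.2‖ ^ s)
    obtain ⟨n, hn1, hn2⟩ := ((hA.eventually (gt_mem_nhds one_pos)).and
      (hB.eventually (gt_mem_nhds one_pos))).exists
    refine ⟨fun x => T (φ n x), (hφ n).comp hTs hT0, lt_of_le_of_lt ?_ hδε⟩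
    calc normSG s g (fun x => T (u x) - T (φ n x)) ≤ ENNReal.ofReal l + ENNReal.ofReal l :=
          add_le_add (luxemburg_le hl hn1.le) (luxemburg_le hl hn2.le)
      _ = δ := by
          rw [← ENNReal.ofReal_add hl.le hl.le, hl_def, add_halves, ENNReal.ofReal_coe_nnreal]

end FracOrlicz

/-! ### Coercivity of the duality across a jump -/

namespace FracOrlicz

variable {d : ℕ} {s : ℝ} {g : Sp d → Sp d → ℝ → ℝ} {Ω : Set (Sp d)} {gLo gUp kLo kUp : ℝ}

/-- The density of the duality `⟨L_g^s u, v⟩`. -/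
noncomputable def pairDens (s : ℝ) (g : Sp d → Sp d → ℝ → ℝ) (u v : Sp d → ℝ)
    (z : Sp d × Sp d) : ℝ :=
  g z.1 z.2 |diffQuot s u z.1 z.2| * diffQuot s u z.1 z.2 * diffQuot s v z.1 z.2
    / ‖z.1 - z.2‖ ^ d

lemma diffQuot_mul_comp_nonneg {T : ℝ → ℝ} (hT : Monotone T) (u : Sp d → ℝ) (x y : Sp d) :
    0 ≤ diffQuot s u x y * diffQuot s (fun x => T (u x)) x y := by
  unfold diffQuot
  rw [div_mul_div_comm]
  refine div_nonneg ?_ (mul_self_nonneg _)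
  rcases le_total (u x) (u y) with h | h
  · exact mul_nonneg_of_nonpos_of_nonpos (sub_nonpos.2 h) (sub_nonpos.2 (hT h))
  · exact mul_nonneg (sub_nonneg.2 h) (sub_nonneg.2 (hT h))

/-- The increments of u and of T(u) have the same sign because T is monotone. -/
lemma pairDens_comp_eq {T : ℝ → ℝ} (hT : Monotone T) (u : Sp d → ℝ) (z : Sp d × Sp d) :
    pairDens s g u (fun x => T (u x)) z
      = g z.1 z.2 |diffQuot s u z.1 z.2| * |diffQuot s u z.1 z.2|
        * |diffQuot s (fun x => T (u x)) z.1 z.2| / ‖z.1 - z.2‖ ^ d := by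
  unfold pairDens
  rw [mul_assoc, mul_assoc, ← abs_mul, abs_of_nonneg (diffQuot_mul_comp_nonneg hT u z.1 z.2)]

lemma pairDens_comp_nonneg {T : ℝ → ℝ} (hT : Monotone T) (u : Sp d → ℝ) {z : Sp d × Sp d}
    (hz : IsProfile gLo gUp kLo kUp (g z.1 z.2)) :
    0 ≤ pairDens s g u (fun x => T (u x)) z := by
  rw [pairDens_comp_eq hT]
  have := hz.mul_self_nonneg (abs_nonneg (diffQuot s u z.1 z.2))
  positivity

lemma pairDens_comp_le (hgLo : 0 < gLo) {T : ℝ → ℝ} (hT : Monotone T) (hT1 : LipschitzWith 1 T)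
    (u : Sp d → ℝ) {z : Sp d × Sp d} (hz : IsProfile gLo gUp kLo kUp (g z.1 z.2)) :
    pairDens s g u (fun x => T (u x)) z
      ≤ 2 ^ (gUp + 1) * (prim (g z.1 z.2) |diffQuot s u z.1 z.2| / ‖z.1 - z.2‖ ^ d) := by
  rw [pairDens_comp_eq hT, ← mul_div_assoc]
  refine div_le_div_of_nonneg_right ?_ (by positivity)
  refine le_trans ?_ (hz.mul_le_prim hgLo (abs_nonneg _))
  exact mul_le_mul_of_nonneg_left (abs_diffQuot_comp_le hT1 u z.1 z.2)
    (hz.mul_self_nonneg (abs_nonneg _))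

lemma aemeasurable_pairDens (hg : IsNonlinearity gLo gUp kLo kUp g) {u v : Sp d → ℝ}
    (hu : AEMeasurable u) (hv : AEMeasurable v) : AEMeasurable (pairDens s g u v) := by
  have h1 : AEMeasurable (fun z : Sp d × Sp d => g z.1 z.2 |diffQuot s u z.1 z.2|) :=
    hg.measurable.comp_aemeasurable (measurable_fst.aemeasurable.prodMk
      (measurable_snd.aemeasurable.prodMk
        (continuous_abs.measurable.comp_aemeasurable (aemeasurable_diffQuot hu))))
  exact ((h1.mul (aemeasurable_diffQuot hu)).mul (aemeasurable_diffQuot hv)).div (by fun_prop)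

/-- Needed because a Bochner integral is 0 when the integrand is not integrable, and then `pairing`
would control nothing. The contraction property replaces Young's inequality: the density is at most
g(|δu|)|δu|². -/
lemma integrable_pairDens_comp (hg : IsNonlinearity gLo gUp kLo kUp g) (hgLo : 0 < gLo)
    {u : Sp d → ℝ} (hu : MemW s g u) {T : ℝ → ℝ} (hT : Monotone T) (hT1 : LipschitzWith 1 T) :
    Integrable (pairDens s g u (fun x => T (u x))) := by
  have hum := hu.aestronglyMeasurable.aemeasurable
  have hQ : Integrable (fun z : Sp d × Sp d =>
      prim (g z.1 z.2) |diffQuot s u z.1 z.2| / ‖z.1 - z.2‖ ^ d) := by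
    refine (lintegral_ofReal_ne_top_iff_integrable ?_ ?_).1 ?_
    · exact ((aemeasurable_prim_pair hg.measurable (aemeasurable_diffQuot hum)).div
        (by fun_prop)).aestronglyMeasurable
    · filter_upwards [hg.ae_profile] with z hz
      exact div_nonneg (hz.prim_nonneg hgLo (abs_nonneg _)) (by positivity)
    · refine ne_top_of_le_ne_top hu.fracModular_lt_top.ne (lintegral_mono fun z => ?_)
      rcases (by positivity : 0 ≤ ‖z.1 - z.2‖ ^ d).eq_or_lt with h0 | h0
      · rw [← h0]; simp
      · rw [ENNReal.ofReal_div_of_pos h0, primG_eq_prim]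
  refine (hQ.const_mul (2 ^ (gUp + 1))).mono' (aemeasurable_pairDens hg hum
    (hT1.continuous.measurable.comp_aemeasurable hum)).aestronglyMeasurable ?_
  filter_upwards [hg.ae_profile] with z hz
  rw [Real.norm_of_nonneg (pairDens_comp_nonneg hT u hz)]
  exact pairDens_comp_le hgLo hT hT1 u hz

/-- The pointwise coercivity of the duality on pairs of points across a jump of the truncation. -/
lemma rpow_le_pairDens (hs : 0 < s) (hgLo : 0 < gLo) (hkLo : 0 < kLo) {θ k t r : ℝ}
    (ht : 0 < t) {T : ℝ → ℝ} (hT : IsTruncation θ k t T) {u : Sp d → ℝ} {z : Sp d × Sp d}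
    (hz : IsProfile gLo gUp kLo kUp (g z.1 z.2)) (h1 : k + t ≤ |u z.1|) (h2 : |u z.2| ≤ k)
    (hr : ‖z.1 - z.2‖ ≤ r) :
    (θ * t) ^ (gLo + 1) ≤ r ^ (s * (gLo + 1))
      * (r ^ d / kLo * pairDens s g u (fun x => T (u x)) z + 1) := by
  have hne : z.1 ≠ z.2 := by
    intro h
    rw [h] at h1
    linarith
  set n := ‖z.1 - z.2‖ with hn
  have hn0 : 0 < n := norm_pos_iff.2 (sub_ne_zero.2 hne)
  have hr0 : 0 < r := hn0.trans_le hr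
  have hF0 := pairDens_comp_nonneg (s := s) hT.monotone u hz
  have hFeq := pairDens_comp_eq (s := s) (g := g) hT.monotone u z
  set F := pairDens s g u (fun x => T (u x)) z
  set D := |diffQuot s (fun x => T (u x)) z.1 z.2| with hD
  set D' := |diffQuot s u z.1 z.2|
  have hD0 : 0 ≤ D := abs_nonneg _
  have hns : 0 < n ^ s := by positivity
  have hDeq : θ * t = D * n ^ s := by
    rw [hD, diffQuot, hT.eq_zero _ h2, sub_zero, abs_div, hT.abs_eq _ h1, ← hn,
      abs_of_pos hns, div_mul_cancel₀ _ hns.ne']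
  have hDD : D ≤ D' := abs_diffQuot_comp_le hT.lipschitz u z.1 z.2
  have hFle : g z.1 z.2 D * D * D ≤ F * n ^ d := by
    rw [hFeq, ← hn, div_mul_cancel₀ _ (by positivity)]
    exact mul_le_mul_of_nonneg_right
      (hz.monotoneOn_mul_self hgLo (mem_Ici.2 hD0) (mem_Ici.2 (hD0.trans hDD)) hDD) hD0
  -- The power lower bound `rpow_le_mul` holds only for arguments at least 1; the summand 1 pays for
  -- the case D ≤ 1.
  have hDp : D ^ (gLo + 1) ≤ r ^ d / kLo * F + 1 := by
    rcases le_total D 1 with h | h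
    · have : D ^ (gLo + 1) ≤ 1 := Real.rpow_le_one hD0 h (by linarith)
      have : 0 ≤ r ^ d / kLo * F := by positivity
      linarith
    · have e1 := (hz.rpow_le_mul h).trans hFle
      have e2 : F * n ^ d ≤ F * r ^ d := by gcongr
      have : D ^ (gLo + 1) ≤ r ^ d / kLo * F := by
        rw [div_mul_eq_mul_div, le_div_iff₀ hkLo]
        linarith
      linarith
  rw [hDeq, Real.mul_rpow hD0 hns.le, ← Real.rpow_mul hn0.le, mul_comm]
  gcongr

/-- The duality controls the measure of the pairs of points across a jump of the truncation. -/
lemma measure_pairs_le (hs : 0 < s) (hg : IsNonlinearity gLo gUp kLo kUp g) (hgLo : 0 < gLo)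
    (hkLo : 0 < kLo) {u : Sp d → ℝ} (hu : MemW s g u) {θ k t r : ℝ} (ht : 0 < t)
    (hr : 0 ≤ r) {T : ℝ → ℝ} (hT : IsTruncation θ k t T) {S : Set (Sp d × Sp d)}
    (hSm : MeasurableSet S) (hSfin : volume S ≠ ⊤)
    (hS : ∀ᵐ z : Sp d × Sp d, z ∈ S → k + t ≤ |u z.1| ∧ |u z.2| ≤ k ∧ ‖z.1 - z.2‖ ≤ r) :
    (θ * t) ^ (gLo + 1) * volume.real S ≤ r ^ (s * (gLo + 1))
      * (r ^ d / kLo * pairing s g u (fun x => T (u x)) + volume.real S) := by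
  have hF := integrable_pairDens_comp hg hgLo hu hT.monotone hT.lipschitz
  have hF0 : 0 ≤ᵐ[volume] pairDens s g u (fun x => T (u x)) := by
    filter_upwards [hg.ae_profile] with z hz using pairDens_comp_nonneg hT.monotone u hz
  have hc : IntegrableOn (fun _ : Sp d × Sp d => (1 : ℝ)) S := integrableOn_const hSfin
  have h1 : ∫ z in S, (θ * t) ^ (gLo + 1) ≤ ∫ z in S, r ^ (s * (gLo + 1))
      * (r ^ d / kLo * pairDens s g u (fun x => T (u x)) z + 1) := by
    refine setIntegral_mono_on_ae (integrableOn_const hSfin)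
      (((hF.integrableOn.const_mul _).add hc).const_mul _) hSm ?_
    filter_upwards [hg.ae_profile, hS] with z hz hzS hzm
    obtain ⟨e1, e2, e3⟩ := hzS hzm
    exact rpow_le_pairDens hs hgLo hkLo ht hT hz e1 e2 e3
  rw [setIntegral_const, integral_const_mul, integral_add (hF.integrableOn.const_mul _) hc,
    integral_const_mul, setIntegral_const, smul_eq_mul, smul_eq_mul, mul_one] at h1
  rw [mul_comm]
  refine h1.trans ?_
  have h2 : ∫ z in S, pairDens s g u (fun x => T (u x)) z ≤ pairing s g u (fun x => T (u x)) :=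
    setIntegral_le_integral hF hF0
  gcongr

end FracOrlicz

/-! ### Measure of the pairs and decay of the level sets -/

namespace FracOrlicz

section Pairs

variable {d : ℕ}

lemma measurableSet_pairs {A B : Set (Sp d)} (hA : MeasurableSet A) (hB : MeasurableSet B)
    (r : ℝ) : MeasurableSet {z : Sp d × Sp d | z.1 ∈ A ∧ z.2 ∉ B ∧ dist z.2 z.1 < r} :=
  (measurable_fst hA).inter ((measurable_snd hB).compl.inter
    (measurableSet_lt (measurable_snd.dist measurable_fst) measurable_const))

lemma volume_pairs {A B : Set (Sp d)} (hA : MeasurableSet A) (hB : MeasurableSet B) (r : ℝ) :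
    volume {z : Sp d × Sp d | z.1 ∈ A ∧ z.2 ∉ B ∧ dist z.2 z.1 < r}
      = ∫⁻ x in A, volume (Metric.ball x r \ B) := by
  rw [Measure.volume_eq_prod, Measure.prod_apply (measurableSet_pairs hA hB r),
    ← lintegral_indicator hA]
  refine lintegral_congr fun x => ?_
  by_cases hx : x ∈ A
  · rw [indicator_of_mem hx]
    congr 1
    ext y
    simp [hx, and_comm]
  · rw [indicator_of_notMem hx]
    convert measure_empty (μ := volume)
    ext y
    simp [hx]

/-- Pairs of points of `A × Bᶜ` at distance less than the radius of balls of measure `2 |B|`. -/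
lemma volume_pairs_bounds {A B : Set (Sp d)} (hA : MeasurableSet A) (hB : MeasurableSet B)
    (hBf : volume B ≠ ⊤) {r : ℝ} (hr : ∀ x : Sp d, volume (Metric.ball x r) = 2 * volume B) :
    volume A * volume B ≤ volume {z : Sp d × Sp d | z.1 ∈ A ∧ z.2 ∉ B ∧ dist z.2 z.1 < r} ∧
    volume {z : Sp d × Sp d | z.1 ∈ A ∧ z.2 ∉ B ∧ dist z.2 z.1 < r}
      ≤ 2 * (volume A * volume B) := by
  rw [volume_pairs hA hB]
  constructor
  -- Removing B from a ball of measure 2|B| leaves at least |B|.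
  · calc volume A * volume B = ∫⁻ _ in A, volume B := by simp [mul_comm]
      _ ≤ _ := lintegral_mono fun x => by
        have h := le_measure_sdiff (μ := volume) (s₁ := Metric.ball x r) (s₂ := B)
        rwa [hr, two_mul, ENNReal.add_sub_cancel_right hBf] at h
  · calc ∫⁻ x in A, volume (Metric.ball x r \ B) ≤ ∫⁻ _ in A, 2 * volume B :=
          lintegral_mono fun x => (measure_mono sdiff_subset).trans (hr x).le
      _ = _ := by simp; ring

end Pairs

variable {d : ℕ} {s : ℝ} {g : Sp d → Sp d → ℝ → ℝ} {Ω : Set (Sp d)} {gLo gUp kLo kUp : ℝ}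

lemma MemW0.volume_level_le (hg : IsNonlinearity gLo gUp kLo kUp g) (hgLo : 0 < gLo)
    {u : Sp d → ℝ} (hu : MemW0 s g Ω u) {k : ℝ} (hk : 0 ≤ k) :
    volume {x | k < |u x|} ≤ volume Ω := by
  refine measure_mono_ae ?_
  filter_upwards [hu.ae_eq_zero hg hgLo] with x hx hxk
  by_contra hxΩ
  have hlt : k < |u x| := hxk
  rw [hx hxΩ, abs_zero] at hlt
  linarith

/-- T(u) is bounded by θt and vanishes off {|u| > k}, so Hölder for f is applied on that set only.
For m = ∞, `m.toReal` = 0 and the exponent is 1, as it should be. -/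
lemma setIntegral_mul_comp_le {f u : Sp d → ℝ} {m : ℝ≥0∞} (hm : 1 ≤ m)
    (hf : MemLp f m (volume.restrict Ω)) {θ k t : ℝ} (hθt : 0 ≤ θ * t) {T : ℝ → ℝ}
    (hT : IsTruncation θ k t T) (hu : AEStronglyMeasurable u)
    (hfin : volume {x | k < |u x|} ≠ ⊤) :
    ∫ x in Ω, f x * T (u x) ≤ θ * t * ((eLpNorm f m (volume.restrict Ω)).toReal
      * volume.real {x | k < |u x|} ^ (1 - 1 / m.toReal)) := by
  set A := {x | k < |u x|} with hA
  have hAm : NullMeasurableSet A := nullMeasurableSet_lt aemeasurable_const hu.aemeasurable.abs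
  have hAm' : NullMeasurableSet A (volume.restrict Ω) := 
    hAm.mono_ac Measure.restrict_le_self.absolutelyContinuous
  have hfA : MemLp f m ((volume.restrict Ω).restrict A) := hf.restrict A
  have hAfin : ((volume.restrict Ω).restrict A) univ ≤ volume A := by
    rw [Measure.restrict_apply_univ]
    exact Measure.restrict_le_self A
  have hexp : 0 ≤ 1 - 1 / m.toReal := by
    rcases eq_or_ne m ⊤ with rfl | hmt
    · simp
    · have : 1 ≤ m.toReal := by simpa using ENNReal.toReal_mono hmt hm
      have := (div_le_one (by linarith)).2 this
      linarith
  have hN : eLpNorm f 1 ((volume.restrict Ω).restrict A)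
      ≤ eLpNorm f m (volume.restrict Ω) * volume A ^ (1 - 1 / m.toReal) := by
    have h := eLpNorm_le_eLpNorm_mul_rpow_measure_univ hm hfA.aestronglyMeasurable
    rw [ENNReal.toReal_one, div_one] at h
    exact h.trans (mul_le_mul' (eLpNorm_mono_measure f Measure.restrict_le_self)
      (ENNReal.rpow_le_rpow hAfin hexp))
  have hNtop : eLpNorm f m (volume.restrict Ω) * volume A ^ (1 - 1 / m.toReal) ≠ ⊤ :=
    ENNReal.mul_ne_top hf.eLpNorm_ne_top (ENNReal.rpow_ne_top_of_nonneg hexp hfin)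
  have hf1 : Integrable f ((volume.restrict Ω).restrict A) :=
    memLp_one_iff_integrable.1 ⟨hfA.aestronglyMeasurable,
      hN.trans_lt (lt_top_iff_ne_top.2 hNtop)⟩
  calc ∫ x in Ω, f x * T (u x) ≤ ∫ x in Ω, A.indicator (fun x => θ * t * ‖f x‖) x := by
        refine (Real.le_norm_self _).trans (norm_integral_le_of_norm_le
          (IntegrableOn.integrable_indicator₀ (hf1.norm.const_mul _) hAm')
          (Eventually.of_forall fun x => ?_))
        by_cases hx : x ∈ A
        · rw [indicator_of_mem hx, norm_mul, mul_comm]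
          gcongr
          exact hT.abs_le (u x)
        · rw [indicator_of_notMem hx, hT.eq_zero _ (not_lt.1 hx), mul_zero, norm_zero]
    _ = θ * t * ∫ x in A, ‖f x‖ ∂(volume.restrict Ω) := by
        rw [integral_indicator₀ hAm', integral_const_mul]
    _ = θ * t * (eLpNorm f 1 ((volume.restrict Ω).restrict A)).toReal := by
        rw [integral_norm_eq_lintegral_enorm hf1.aestronglyMeasurable,
          eLpNorm_one_eq_lintegral_enorm]
    _ ≤ _ := by
        refine mul_le_mul_of_nonneg_left ?_ hθt
        refine (ENNReal.toReal_mono hNtop hN).trans (le_of_eq ?_)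
        rw [ENNReal.toReal_mul, ← ENNReal.toReal_rpow, measureReal_def]

lemma exists_radius (hd : 0 < d) {a : ℝ} (ha : 0 < a) :
    ∃ r : ℝ, 0 < r ∧ r ^ d * volume.real (Metric.ball (0 : Sp d) 1) = a ∧
      r = (a / volume.real (Metric.ball (0 : Sp d) 1)) ^ (1 / (d : ℝ)) ∧
      ∀ x : Sp d, volume (Metric.ball x r) = ENNReal.ofReal a := by
  have : Nonempty (Fin d) := ⟨⟨0, hd⟩⟩
  set b := volume.real (Metric.ball (0 : Sp d) 1) with hb
  have hb0 : 0 < b := ENNReal.toReal_pos (Metric.measure_ball_pos _ _ one_pos).ne'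
    measure_ball_lt_top.ne
  refine ⟨(a / b) ^ (1 / (d : ℝ)), by positivity, ?_, rfl, fun x => ?_⟩
  · rw [one_div, Real.rpow_inv_natCast_pow (by positivity) hd.ne']
    field_simp
  · rw [Measure.addHaar_ball _ _ (by positivity), finrank_euclideanSpace_fin, one_div,
      Real.rpow_inv_natCast_pow (by positivity) hd.ne',
      ← ENNReal.ofReal_toReal (measure_ball_lt_top (μ := volume) (x := (0 : Sp d)) (r := 1)).ne,
      ← measureReal_def, ← hb, ← ENNReal.ofReal_mul (by positivity)]
    congr 1
    field_simp

/-- Decay of the measure of the superlevel sets of a solution. -/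
lemma IsSolution.level_step (hs : 0 < s) (hg : IsNonlinearity gLo gUp kLo kUp g) (hgLo : 0 < gLo)
    (hkLo : 0 < kLo) (hd : 0 < d) (hΩ : volume Ω ≠ ⊤) {m : ℝ≥0∞} (hm : 1 ≤ m) {f u : Sp d → ℝ}
    (hf : MemLp f m (volume.restrict Ω)) (hu : IsSolution s g Ω f u) {θ k t : ℝ} (hθ : 0 < θ)
    (hk : 0 ≤ k) (ht : 0 < t) {T : ℝ → ℝ} (hT : IsTruncation θ k t T) {a b N : ℝ}
    (ha : a = volume.real {x | k < |u x|})
    (hb : b = volume.real (Metric.ball (0 : Sp d) 1))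
    (hN : N = (eLpNorm f m (volume.restrict Ω)).toReal) :
    (θ * t) ^ (gLo + 1) * volume.real {x | k + t < |u x|}
      ≤ (2 * a / b) ^ (s * (gLo + 1) / d)
        * (2 / (b * kLo) * (θ * t * (N * a ^ (1 - 1 / m.toReal))) + 2 * a) := by
  have hlev : ∀ j : ℝ, 0 ≤ j → volume {x | j < |u x|} ≠ ⊤ := fun j hj =>
    ne_top_of_le_ne_top hΩ (hu.memW0.volume_level_le hg hgLo hj)
  have hb0 : 0 < b := hb ▸ ENNReal.toReal_pos (Metric.measure_ball_pos _ _ one_pos).ne'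
    measure_ball_lt_top.ne
  have hN0 : 0 ≤ N := hN ▸ ENNReal.toReal_nonneg
  have ha0 : 0 ≤ a := ha ▸ measureReal_nonneg
  set a' := volume.real {x | k + t < |u x|} with ha'
  have ha'a : a' ≤ a := by
    rw [ha, ha']
    refine measureReal_mono (fun x hx => ?_) (hlev k hk)
    have hx' : k + t < |u x| := hx
    exact (by linarith : k < |u x|)
  have ha'0 : 0 ≤ a' := measureReal_nonneg
  -- If a = 0 there is no positive radius to choose, and a could not be cancelled at the end.
  rcases ha0.eq_or_lt with h0 | ha0
  · have : a' = 0 := by linarith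
    rw [this, mul_zero]
    positivity
  have hP : pairing s g u (fun x => T (u x)) ≤ θ * t * (N * a ^ (1 - 1 / m.toReal)) := by
    rw [hu.weak _ (hu.memW0.comp hg hgLo hT.contDiff hT.lipschitz
      (hT.eq_zero 0 (by simpa using hk))), hN, ha]
    exact setIntegral_mul_comp_le hm hf (by positivity) hT
      hu.memW0.memW.aestronglyMeasurable (hlev k hk)
  -- A measurable representative of u makes the set of pairs measurable.
  set w := hu.memW0.memW.aestronglyMeasurable.mk u with hw
  have hwm : Measurable w := hu.memW0.memW.aestronglyMeasurable.stronglyMeasurable_mk.measurable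
  have hwu : u =ᵐ[volume] w := hu.memW0.memW.aestronglyMeasurable.ae_eq_mk
  have hset : ∀ j : ℝ, volume {x | j < |w x|} = volume {x | j < |u x|} := fun j => by
    refine measure_congr ?_
    filter_upwards [hwu] with x hx
    exact congrArg (fun y : ℝ => j < |y|) hx.symm
  have hms : ∀ j : ℝ, MeasurableSet {x | j < |w x|} := fun j =>
    measurableSet_lt measurable_const (continuous_abs.measurable.comp hwm)
  obtain ⟨r, hr0, hr1, hr2, hr3⟩ := exists_radius hd (mul_pos two_pos ha0)
  rw [← hb] at hr1 hr2
  have hak : volume {x | k < |w x|} = ENNReal.ofReal a := by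
    rw [hset, ha, ofReal_measureReal (hlev k hk)]
  have hak' : volume {x | k + t < |w x|} = ENNReal.ofReal a' := by
    rw [hset, ha', ofReal_measureReal (hlev _ (by linarith))]
  obtain ⟨hS1, hS2⟩ := volume_pairs_bounds (hms (k + t)) (hms k)
    (by rw [hak]; exact ENNReal.ofReal_ne_top) (r := r) fun x => by
      rw [hr3, hak, ENNReal.ofReal_mul zero_le_two, ENNReal.ofReal_ofNat]
  have hSm := measurableSet_pairs (hms (k + t)) (hms k) r
  set S := {z : Sp d × Sp d | z.1 ∈ {x | k + t < |w x|} ∧ z.2 ∉ {x | k < |w x|} ∧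
    dist z.2 z.1 < r} with hS
  rw [hak, hak', ← ENNReal.ofReal_mul ha'0] at hS1 hS2
  replace hS2 : volume S ≤ ENNReal.ofReal (2 * (a' * a)) := by
    rwa [ENNReal.ofReal_mul zero_le_two, ENNReal.ofReal_ofNat]
  have hSfin : volume S ≠ ⊤ := ne_top_of_le_ne_top ENNReal.ofReal_ne_top hS2
  have hS1' : a' * a ≤ volume.real S := (ENNReal.ofReal_le_iff_le_toReal hSfin).1 hS1
  have hS2' : volume.real S ≤ 2 * (a' * a) :=
    ENNReal.toReal_le_of_le_ofReal (by positivity) hS2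
  have hkey := measure_pairs_le hs hg hgLo hkLo hu.memW0.memW ht hr0.le hT hSm hSfin (by
    filter_upwards [Measure.quasiMeasurePreserving_fst.ae hwu,
      Measure.quasiMeasurePreserving_snd.ae hwu] with z hz1 hz2 hzS
    obtain ⟨e1, e2, e3⟩ := hzS
    rw [hz1, hz2]
    refine ⟨le_of_lt e1, not_lt.1 e2, ?_⟩
    rw [← dist_eq_norm, dist_comm]
    exact e3.le)
  have hrs : r ^ (s * (gLo + 1)) = (2 * a / b) ^ (s * (gLo + 1) / d) := by
    rw [hr2, ← Real.rpow_mul (by positivity)]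
    congr 1
    ring
  have hrd : r ^ d / kLo = a * (2 / (b * kLo)) := by
    rw [eq_div_of_mul_eq hb0.ne' hr1]
    field_simp
  rw [hrs, hrd] at hkey
  -- The factor a to cancel appears on the left from |S| ≥ a'a, and on the right from r^d = 2a/b and
  -- from |S| ≤ 2a'a ≤ 2a².
  refine le_of_mul_le_mul_right ?_ ha0
  calc (θ * t) ^ (gLo + 1) * a' * a = (θ * t) ^ (gLo + 1) * (a' * a) := by ring
    _ ≤ (θ * t) ^ (gLo + 1) * volume.real S := by gcongr
    _ ≤ _ := hkey
    _ ≤ (2 * a / b) ^ (s * (gLo + 1) / d)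
        * (a * (2 / (b * kLo)) * (θ * t * (N * a ^ (1 - 1 / m.toReal))) + 2 * (a * a)) := by
      gcongr
      exact hS2'.trans (by gcongr)
    _ = _ := by ring

end FracOrlicz

/-! ### The De Giorgi iteration and the bound -/

namespace FracOrlicz

/-- The level iteration of De Giorgi, with gain `β` and a bound that only sees the data. -/
lemma exists_vanishing_level {p β θ V D E : ℝ} (hp : 1 < p) (hβ : 0 < β) (hθ : 0 < θ)
    (hV : 0 < V) (hD : 0 ≤ D) (hE : 0 ≤ E) :
    ∃ M : ℝ, 0 ≤ M ∧ ∀ a : ℝ → ℝ, (∀ k, 0 ≤ k → 0 ≤ a k) → (∀ k, 0 ≤ k → a k ≤ V) →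
      (∀ k l, 0 ≤ k → k ≤ l → a l ≤ a k) →
      (∀ k t, 0 ≤ k → 0 < t → (θ * t) ^ p * a (k + t) ≤ D * (t + E) * a k ^ (1 + β)) →
      a M = 0 := by
  have hp0 : 0 < p := by linarith
  set b : ℝ := 2 ^ p with hb
  have hb1 : 1 < b := Real.one_lt_rpow one_lt_two hp0
  have hb0 : 0 < b := by linarith
  -- Halving the increment costs b = 2^p per step; this q satisfies b q^β = 1, so the superlinear
  -- gain compensates that loss exactly.
  set q : ℝ := b ^ (-(1 / β)) with hq
  have hq0 : 0 < q := by positivity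
  have hq1 : q < 1 := Real.rpow_lt_one_of_one_lt_of_neg hb1 (by simpa using hβ)
  have hbq : b * q ^ β = 1 := by
    rw [hq, ← Real.rpow_mul hb0.le, neg_mul, one_div_mul_cancel hβ.ne', Real.rpow_neg_one,
      mul_inv_cancel₀ hb0.ne']
  -- With t proportional to M, the left side of the step grows like M^p and the right side at most
  -- linearly; p > 1 leaves M^(-(p-1)), which tends to 0.
  obtain ⟨M, hM1, hM⟩ : ∃ M : ℝ, 1 ≤ M ∧
      D * (1 + E) * b * V ^ β / θ ^ p * M ^ (-(p - 1)) ≤ q := by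
    have h := (tendsto_rpow_neg_atTop (sub_pos.2 hp)).const_mul
      (D * (1 + E) * b * V ^ β / θ ^ p)
    rw [mul_zero] at h
    obtain ⟨M, h1, h2⟩ := ((h.eventually (gt_mem_nhds hq0)).and (eventually_ge_atTop 1)).exists
    exact ⟨M, h2, h1.le⟩
  have hM0 : 0 < M := by linarith
  refine ⟨M, hM0.le, fun a ha0 haV hanti hstep => ?_⟩
  have hk0 : ∀ n : ℕ, 0 ≤ M * (1 - (1 / 2) ^ n) := fun n =>
    mul_nonneg hM0.le (sub_nonneg.2 (pow_le_one₀ (by norm_num) (by norm_num)))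
  -- The levels increase to M. The induction starts from `a 0 ≤ V`, so no initial smallness is
  -- required.
  have hind : ∀ n : ℕ, a (M * (1 - (1 / 2) ^ n)) ≤ V * q ^ n := by
    intro n
    induction n with
    | zero => simpa using haV 0 le_rfl
    | succ n ih =>
      set t : ℝ := M * (1 / 2) ^ (n + 1) with ht
      have ht0 : 0 < t := by positivity
      have htM : t ≤ M := mul_le_of_le_one_right hM0.le (pow_le_one₀ (by norm_num) (by norm_num))
      have hkt : M * (1 - (1 / 2) ^ n) + t = M * (1 - (1 / 2) ^ (n + 1)) := by
        rw [ht]; ring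
      have h1 := hstep _ t (hk0 n) ht0
      rw [hkt] at h1
      have hx0 := ha0 _ (hk0 n)
      set x := a (M * (1 - (1 / 2) ^ n))
      set y := a (M * (1 - (1 / 2) ^ (n + 1)))
      have h2 : x ^ (1 + β) ≤ V * V ^ β * (q ^ n * (q ^ β) ^ n) := by
        calc x ^ (1 + β) ≤ (V * q ^ n) ^ (1 + β) := by gcongr
          _ = V * V ^ β * (q ^ n * (q ^ β) ^ n) := by
            rw [Real.rpow_add (by positivity), Real.rpow_one, Real.mul_rpow hV.le (by positivity),
              ← Real.rpow_natCast q n, ← Real.rpow_mul hq0.le, ← Real.rpow_natCast (q ^ β) n,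
              ← Real.rpow_mul hq0.le, mul_comm (n : ℝ) β]
            ring
      have h3 : D * (t + E) ≤ D * (1 + E) * M := by
        rw [mul_assoc]
        refine mul_le_mul_of_nonneg_left ?_ hD
        nlinarith
      have h4 : (θ * t) ^ p = θ ^ p * (M * M ^ (p - 1)) * (b * b ^ n)⁻¹ := by
        rw [ht, Real.mul_rpow hθ.le (by positivity), Real.mul_rpow hM0.le (by positivity),
          ← pow_succ', one_div, inv_pow, Real.inv_rpow (by positivity), hb,
          Real.rpow_pow_comm two_pos.le]
        have : M ^ p = M * M ^ (p - 1) := by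
          rw [mul_comm, ← Real.rpow_add_one hM0.ne', sub_add_cancel]
        rw [this]
        ring
      have hMp : M ^ (-(p - 1)) = (M ^ (p - 1))⁻¹ := Real.rpow_neg hM0.le _
      have hθp : 0 < θ ^ p := by positivity
      have hMp0 : 0 < M ^ (p - 1) := by positivity
      have hbn : 0 < b ^ n := by positivity
      have hbqn : b ^ n * (q ^ β) ^ n = 1 := by rw [← mul_pow, hbq, one_pow]
      have h5 : (θ * t) ^ p * y ≤ (θ * t) ^ p * (V * q ^ (n + 1)) := by
        calc (θ * t) ^ p * y ≤ D * (t + E) * x ^ (1 + β) := h1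
          _ ≤ D * (1 + E) * M * (V * V ^ β * (q ^ n * (q ^ β) ^ n)) := by gcongr
          _ = (θ * t) ^ p * (V * q ^ n) * (D * (1 + E) * b * V ^ β / θ ^ p * M ^ (-(p - 1)))
              * (b ^ n * (q ^ β) ^ n) := by
            rw [h4, hMp]
            field_simp
          _ ≤ (θ * t) ^ p * (V * q ^ n) * q * (b ^ n * (q ^ β) ^ n) := by gcongr
          _ = (θ * t) ^ p * (V * q ^ (n + 1)) := by rw [hbqn]; ring
      exact le_of_mul_le_mul_left h5 (by positivity)
  have hlim : Tendsto (fun n : ℕ => V * q ^ n) atTop (𝓝 0) := by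
    simpa using (tendsto_pow_atTop_nhds_zero_of_lt_one hq0.le hq1).const_mul V
  refine le_antisymm (ge_of_tendsto' hlim fun n => ?_) (ha0 M hM0.le)
  refine (hanti _ M (hk0 n) ?_).trans (hind n)
  exact mul_le_of_le_one_right hM0.le (by linarith [pow_nonneg (by norm_num : (0 : ℝ) ≤ 1 / 2) n])

/-- The boundedness estimate, for each value of the norm of the right-hand side. -/
lemma exists_bound_solution {d : ℕ} {s gLo gUp kLo kUp : ℝ} (hs : 0 < s) (hgLo : 0 < gLo)
    (hkLo : 0 < kLo) (hsd : s * (gLo + 1) < d) {Ω : Set (Sp d)} (hΩ : volume Ω ≠ ⊤)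
    {m : ℝ≥0∞} (hm : ENNReal.ofReal (d / (s * (gLo + 1))) < m) (N : ℝ≥0∞) :
    ∃ C : ℝ≥0, ∀ (g : Sp d → Sp d → ℝ → ℝ) (f u : Sp d → ℝ),
      IsNonlinearity gLo gUp kLo kUp g → MemLp f m (volume.restrict Ω) →
      IsSolution s g Ω f u → eLpNorm f m (volume.restrict Ω) = N → ∀ᵐ x, |u x| ≤ C := by
  obtain ⟨θ, hθ, htr⟩ := exists_isTruncation
  have hσp : 0 < s * (gLo + 1) := by positivity
  have hd0 : (0 : ℝ) < d := hσp.trans hsd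
  have hd : 0 < d := by exact_mod_cast hd0
  have hm1 : 1 ≤ m := by
    refine le_trans ?_ hm.le
    rw [ENNReal.one_le_ofReal, one_le_div hσp]
    exact hsd.le
  set α : ℝ := 1 / m.toReal with hα
  have hα0 : 0 ≤ α := by positivity
  set σ : ℝ := s * (gLo + 1) / d with hσ
  have hσ0 : 0 < σ := by positivity
  -- The lower bound on m enters here: it makes the gain β = σ - α positive.
  have hασ : α < σ := by
    rcases eq_or_ne m ⊤ with rfl | hmt
    · simpa [hα] using hσ0
    · have h := (ENNReal.ofReal_lt_iff_lt_toReal (by positivity) hmt).1 hm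
      rw [hα, hσ, ← one_div_div (d : ℝ)]
      exact one_div_lt_one_div_of_lt (by positivity) h
  set b : ℝ := volume.real (Metric.ball (0 : Sp d) 1) with hb
  have hb0 : 0 < b := ENNReal.toReal_pos (Metric.measure_ball_pos _ _ one_pos).ne'
    measure_ball_lt_top.ne
  -- The + 1 keeps V positive even when Ω is null.
  set V : ℝ := volume.real Ω + 1 with hV
  have hV0 : 0 < V := add_pos_of_nonneg_of_pos measureReal_nonneg one_pos
  set D₁ : ℝ := 2 / (b * kLo) * θ * N.toReal with hD₁
  have hD₁0 : 0 ≤ D₁ := by positivity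
  -- E = 2V^α absorbs the term 2a of `level_step`, since a = a^(1-α) a^α ≤ a^(1-α) V^α; the + 1 in D
  -- gives that term a coefficient at least 1.
  obtain ⟨M, hM0, hM⟩ := exists_vanishing_level (p := gLo + 1) (β := σ - α) (θ := θ) (V := V)
    (D := (2 / b) ^ σ * (D₁ + 1)) (E := 2 * V ^ α) (by linarith) (by linarith) hθ hV0
    (by positivity) (by positivity)
  refine ⟨⟨M, hM0⟩, fun g f u hg hf hu hN => ?_⟩
  have hfin : ∀ k : ℝ, 0 ≤ k → volume {x | k < |u x|} ≠ ⊤ := fun k hk =>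
    ne_top_of_le_ne_top hΩ (hu.memW0.volume_level_le hg hgLo hk)
  have haV : ∀ k : ℝ, 0 ≤ k → volume.real {x | k < |u x|} ≤ V := fun k hk =>
    (ENNReal.toReal_mono hΩ (hu.memW0.volume_level_le hg hgLo hk)).trans (le_add_of_nonneg_right
      zero_le_one)
  have hMu := hM (fun k => volume.real {x | k < |u x|}) (fun k _ => measureReal_nonneg) haV
    (fun k l hk hkl => measureReal_mono (fun x hx => lt_of_le_of_lt hkl hx) (hfin k hk)) ?_
  · have h0 : volume {x | M < |u x|} = 0 :=
      (measureReal_eq_zero_iff (hfin M hM0)).1 hMu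
    filter_upwards [measure_eq_zero_iff_ae_notMem.1 h0] with x hx
    exact not_lt.1 hx
  · intro k t hk ht
    obtain ⟨T, hT⟩ := htr k t hk ht
    refine (hu.level_step hs hg hgLo hkLo hd hΩ hm1 hf hθ hk ht hT rfl hb
      (by rw [hN])).trans ?_
    have haVk := haV k hk
    set a := volume.real {x | k < |u x|}
    have ha0 : 0 ≤ a := measureReal_nonneg
    rcases ha0.eq_or_lt with h0 | ha0
    · rw [← h0, mul_zero, zero_div, Real.zero_rpow hσ0.ne', zero_mul]
      positivity
    have e1 : (2 * a / b) ^ σ = (2 / b) ^ σ * a ^ σ := by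
      rw [← Real.mul_rpow (by positivity) ha0.le]
      congr 1
      ring
    have e2 : a ^ (1 + (σ - α)) = a ^ σ * a ^ (1 - α) := by
      rw [← Real.rpow_add ha0]
      congr 1
      ring
    have e3 : a = a ^ (1 - α) * a ^ α := by
      rw [← Real.rpow_add ha0]
      simp
    have e4 : a ^ α ≤ V ^ α := Real.rpow_le_rpow ha0.le haVk hα0
    have hpos : 0 ≤ a ^ (1 - α) := by positivity
    rw [e1, e2]
    calc (2 / b) ^ σ * a ^ σ * (2 / (b * kLo) * (θ * t * (N.toReal * a ^ (1 - α))) + 2 * a)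
        = (2 / b) ^ σ * a ^ σ * (D₁ * t * a ^ (1 - α) + 2 * (a ^ (1 - α) * a ^ α)) := by
          rw [← e3, hD₁]; ring
      _ ≤ (2 / b) ^ σ * a ^ σ * ((D₁ + 1) * (t + 2 * V ^ α) * a ^ (1 - α)) := by
          gcongr
          have h1 : D₁ * t + 2 * a ^ α ≤ (D₁ + 1) * (t + 2 * V ^ α) := by
            have : 0 ≤ D₁ * (2 * V ^ α) := by positivity
            linarith
          calc _ = (D₁ * t + 2 * a ^ α) * a ^ (1 - α) := by ring
            _ ≤ _ := by gcongr
      _ = _ := by ring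

end FracOrlicz

theorem mainTheorem4 (d : ℕ) (s gLo gUp kLo kUp : ℝ) (hs0 : 0 < s) (hs1 : s < 1)
    (hgLo : 0 < gLo) (hgUp : gLo ≤ gUp) (hkLo : 0 < kLo) (hkUp : kLo ≤ kUp)
    (hsd : s * (gLo + 1) < d)
    (Ω : Set (FracOrlicz.Sp d)) (hΩ : IsOpen Ω) (hΩb : Bornology.IsBounded Ω)
    (m : ℝ≥0∞) (hm : ENNReal.ofReal (d / (s * (gLo + 1))) < m) :
    ∃ C : ℝ≥0∞ → ℝ≥0∞ → ℝ≥0,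
      ∀ (g : FracOrlicz.Sp d → FracOrlicz.Sp d → ℝ → ℝ) (f u : FracOrlicz.Sp d → ℝ),
        FracOrlicz.IsNonlinearity gLo gUp kLo kUp g →
        MemLp f m (volume.restrict Ω) →
        FracOrlicz.IsSolution s g Ω f u →
        eLpNorm u ⊤ (volume.restrict Ω) ≤
          C (FracOrlicz.normSG s g u) (eLpNorm f m (volume.restrict Ω)) := by
  choose C hC using FracOrlicz.exists_bound_solution (gUp := gUp) (kUp := kUp) hs0 hgLo hkLo hsd
    hΩb.measure_lt_top.ne hm
  -- The constant depends on the norm of f but is the same for all values of the norm of u.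
  refine ⟨fun _ N => C N, fun g f u hg hf hu => ?_⟩
  rw [eLpNorm_exponent_top]
  refine (eLpNormEssSup_le_of_ae_bound
    (ae_restrict_of_ae (hC _ g f u hg hf hu rfl))).trans (le_of_eq ?_)
  rw [ENNReal.ofReal_coe_nnreal]
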